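/- Let $E=\mathrm{Sh}(C,J)$ be the topos of sheaves on a small site $(C,J)$, let $A$ be a sheaf of (unital, not necessarily commutative) rings on $(C,J)$, and let $A\text{-mod}$ be the category of sheaves of left $A$-modules. Equip $A\text{-mod}$ with the following topology: a family $\{f_i:M_i\to M\}_{i\in I}$ is covering if for every object $U$ of $C$ and every finite set of sections $\Lambda\subseteq\Gamma(U,M)$ there is a covering sieve of $U$ such that for each $V\to U$ in it there is an index $i\in I$ for which all the restrictions $s|_V$, $s\in\Lambda$, lift along $f_i$ to sections in $\Gamma(V,M_i)$. Let $\mathrm{Arr}(A\text{-mod})$ be the category whose objects are the arrows $N\to M$ of $A\text{-mod}$ and whose morphisms are the commutative squares, and let $q:\mathrm{Arr}(A\text{-mod})\to A\text{-mod}$ be the functor sending an arrow to its codomain. Then $q$ is a stack: $q$ is a fibered category, and for every covering family $\{M_i\to M\}_{i\in I}$ in $A\text{-mod}$ the pullback functor from the fiber of $q$ over $M$ to the category of descent data relative to $\{M_i\to M\}_{i\in I}$ is an equivalence of categories. (The fibers are not required to be groupoids.) -/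

import Mathlib

open CategoryTheory Opposite

universe u v₁ v₂ u₁ u₂

namespace ModuleSite

variable {C : Type u} [SmallCategory C] {J : GrothendieckTopology C} {A : Sheaf J RingCat.{u}}

/-- The image in `Γ(U, M)` of a section of `N` under a map `f : N ⟶ M` of sheaves of `A`-modules. -/
def mapSection {N M : SheafOfModules.{u} A} (f : N ⟶ M) {U : C} (t : N.val.obj (op U)) :
    M.val.obj (op U) :=
  f.val.app (op U) t

/-- The restriction to `V` of a section of `M` over `U`, along `g : V ⟶ U`. -/
noncomputable def restrict (M : SheafOfModules.{u} A) {U V : C} (g : V ⟶ U) (s : M.val.obj (op U)) :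
    M.val.obj (op V) :=
  M.val.map g.op s

/-- A family of maps `f i : N i ⟶ M` of sheaves of `A`-modules is *covering* if every finite set
`Λ ⊆ Γ(U, M)` of sections lifts, locally on `U`, to a single member of the family: there is a
covering sieve `T` of `U` such that for each `g : V ⟶ U` in `T` there is an index `i` for which all
the restrictions `s|_V`, `s ∈ Λ`, come from sections of `N i` over `V`. -/
def IsCoveringFamily {ι : Type*} {M : SheafOfModules.{u} A} {N : ι → SheafOfModules.{u} A}
    (f : ∀ i, N i ⟶ M) : Prop :=
  ∀ (U : C) (Λ : Finset (M.val.obj (op U))), ∃ T ∈ J U, ∀ ⦃V : C⦄ (g : V ⟶ U), T g →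
    ∃ i, ∀ s ∈ Λ, ∃ t : (N i).val.obj (op V), mapSection (f i) t = restrict M g s

lemma mapSection_comp {P N M : SheafOfModules.{u} A} (h : P ⟶ N) (f : N ⟶ M) {U : C}
    (t : P.val.obj (op U)) : mapSection (h ≫ f) t = mapSection f (mapSection h t) := rfl

lemma mapSection_id {M : SheafOfModules.{u} A} {U : C}
    (t : M.val.obj (op U)) : mapSection (𝟙 M) t = t := rfl

lemma restrict_comp (M : SheafOfModules.{u} A) {U V W : C} (g : V ⟶ U) (h : W ⟶ V)
    (s : M.val.obj (op U)) : restrict M (h ≫ g) s = restrict M h (restrict M g s) := by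
  exact PresheafOfModules.map_comp_apply M.val g.op h.op s

lemma restrict_mapSection {N M : SheafOfModules.{u} A} (f : N ⟶ M) {U V : C} (g : V ⟶ U)
    (t : N.val.obj (op U)) : restrict M g (mapSection f t) = mapSection f (restrict N g t) :=
  (PresheafOfModules.naturality_apply f.val g.op t).symm

/-- Sections of a fibre product are pairs of sections with the same image. -/
lemma exists_pullback_section {N P M : SheafOfModules.{u} A} (f : N ⟶ M) (h : P ⟶ M) {U : C}
    (x : N.val.obj (op U)) (y : P.val.obj (op U)) (e : mapSection f x = mapSection h y) :
    ∃ z : (Limits.pullback f h).val.obj (op U),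
      mapSection (Limits.pullback.fst f h) z = x ∧ mapSection (Limits.pullback.snd f h) z = y := by
  have hp := ((IsPullback.of_hasPullback f h).map (SheafOfModules.evaluation A (op U))).map
    (forget (ModuleCat (A.obj.obj (op U))))
  obtain ⟨z, hz⟩ := (Limits.Types.isPullback_iff _ _ _ _).1 hp |>.2.2 x y e
  exact ⟨z, hz⟩

end ModuleSite

open ModuleSite in
/-- The topology on the category `A-mod` of sheaves of `A`-modules: a sieve covers `M` if the family
of all its arrows is covering. -/
noncomputable def modTopology {C : Type u} [SmallCategory C] {J : GrothendieckTopology C}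
    (A : Sheaf J RingCat.{u}) : GrothendieckTopology (SheafOfModules.{u} A) where
  sieves M := {S | IsCoveringFamily (fun f : S.arrows.category ↦ f.obj.hom)}
  top_mem' M U Λ := by
    refine ⟨⊤, J.top_mem U, fun V g _ ↦ ⟨⟨Over.mk (𝟙 M), trivial⟩, fun s _ ↦ ⟨restrict M g s, rfl⟩⟩⟩
  pullback_stable' M M' S h hS := by
    classical
    intro U Λ
    obtain ⟨T, hT, H⟩ := hS U (Λ.image (mapSection h))
    refine ⟨T, hT, fun V g hg ↦ ?_⟩
    obtain ⟨⟨N, hN⟩, HN⟩ := H g hg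
    refine ⟨⟨Over.mk (Limits.pullback.snd N.hom h), ?_⟩, fun s hs ↦ ?_⟩
    · change S (Limits.pullback.snd N.hom h ≫ h)
      rw [← Limits.pullback.condition]
      exact S.downward_closed hN _
    · obtain ⟨t, ht⟩ := HN _ (Finset.mem_image_of_mem _ hs)
      obtain ⟨z, -, hz⟩ := exists_pullback_section N.hom h t (restrict M' g s)
        (ht.trans (restrict_mapSection h g s))
      exact ⟨z, hz⟩
  transitive' M S hS R hR := by
    classical
    intro U Λ
    obtain ⟨T, hT, H⟩ := hS U Λ
    have key : ∀ ⦃V : C⦄ (g : V ⟶ U), T g → ∃ T' ∈ J V, ∀ ⦃W : C⦄ (k : W ⟶ V), T' k →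
        ∃ i : R.arrows.category, ∀ s ∈ Λ, ∃ t : i.obj.left.val.obj (op W),
          mapSection i.obj.hom t = restrict M (k ≫ g) s := by
      intro V g hg
      obtain ⟨⟨N, hN⟩, HN⟩ := H g hg
      choose! t ht using HN
      obtain ⟨T', hT', H'⟩ := hR hN V (Λ.image t)
      refine ⟨T', hT', fun W k hk ↦ ?_⟩
      obtain ⟨⟨P, hP⟩, HP⟩ := H' k hk
      refine ⟨⟨Over.mk (P.hom ≫ N.hom), hP⟩, fun s hs ↦ ?_⟩
      obtain ⟨w, hw⟩ := HP _ (Finset.mem_image_of_mem _ hs)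
      refine ⟨w, ?_⟩
      change mapSection (P.hom ≫ N.hom) w = _
      rw [mapSection_comp, restrict_comp, ← ht s hs, restrict_mapSection]
      exact congrArg _ hw
    choose T' hT' H' using key
    exact ⟨Sieve.bind T (fun V g hg ↦ T' g hg), J.bind_covering hT (fun V g hg ↦ hT' g hg), by
      rintro W _ ⟨V, k, g, hg, hk, rfl⟩
      exact H' g hg k hk⟩

namespace ModuleSite

variable {C : Type u} [SmallCategory C] {J : GrothendieckTopology C} {A : Sheaf J RingCat.{u}}

/-- A family of maps generates a covering sieve of `modTopology A` exactly when it is covering. -/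
lemma ofArrows_mem_modTopology_iff {ι : Type*} {M : SheafOfModules.{u} A}
    {N : ι → SheafOfModules.{u} A} (f : ∀ i, N i ⟶ M) :
    Sieve.ofArrows N f ∈ modTopology A M ↔ IsCoveringFamily f := by
  refine forall₂_congr fun U Λ ↦ exists_congr fun T ↦ and_congr_right fun _ ↦
    forall₃_congr fun V g _ ↦ ⟨?_, ?_⟩
  · rintro ⟨⟨P, hP⟩, H⟩
    obtain ⟨_, a, _, ⟨i⟩, hi⟩ := hP
    refine ⟨i, fun s hs ↦ ?_⟩
    obtain ⟨t, ht⟩ := H s hs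
    refine ⟨mapSection a t, ?_⟩
    rw [← mapSection_comp, hi]
    exact ht
  · rintro ⟨i, H⟩
    exact ⟨⟨Over.mk (f i), Sieve.ofArrows_mk _ _ i⟩, H⟩

end ModuleSite

/-- A functor `p : 𝒳 ⥤ 𝒮` is a *stack* for a Grothendieck topology `J` on `𝒮` if it is a fibred
category and the pseudofunctor `F : 𝒮ᵒᵖ ⥤ Cat` of its fibres is a stack: for every covering sieve of
every `S`, the functor from `F(S)` to the category of descent data is an equivalence. (No condition
that the fibres be groupoids is imposed.) A pseudofunctor of fibres of `p` is one whose total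
category is equivalent to `𝒳` over `𝒮`. It is unique up to equivalence, so that it does not matter
which one is used. -/
def IsStackOver {𝒳 : Type u₂} [Category.{v₂} 𝒳] {𝒮 : Type u₁} [Category.{v₁} 𝒮]
    (p : 𝒳 ⥤ 𝒮) (J : GrothendieckTopology 𝒮) : Prop :=
  p.IsFibered ∧
    ∃ (F : Pseudofunctor (LocallyDiscrete 𝒮ᵒᵖ) Cat.{v₂, u₂}) (e : 𝒳 ≌ F.CoGrothendieck),
      Nonempty (e.functor ⋙ Pseudofunctor.CoGrothendieck.forget F ≅ p) ∧ F.IsStack J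

-- The fibre of the codomain functor over `M` is the slice over `M`, with fibre product as base
-- change, so the claim is descent for slices of `A-mod`.
--
-- Morphisms descend because the topology is subcanonical. A map out of `N` is determined by its
-- values on sections; sections of `N` lift locally to a member of a covering family, compatible
-- maps on the members give values independent of the lift, and these values glue in the target.
-- Since any two sections lift together to one member, the glued map is additive. For a map over `S`
-- between objects `N` and `P`, this is applied to the base changes of `N`, which cover `N`
-- (`isPrestack_overPseudofunctor`).
--
-- For objects, a descent datum `D` over a family `X i ⟶ M` is read as a transport operation: an
-- element of `D i` and an element `y` of `X j` with the same image in `M` give an element of `D j`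
-- over `y`. The cocycle condition says that transport is transitive. On sections, "being a
-- transport of" is therefore an equivalence relation, and it is local. Dividing the sections of all
-- the `D i` by it and sheafifying gives a sheaf of sets `F` over `M`, and `D i` is the fibre
-- product of `F` and `X i` over `M`.
--
-- The module structure on `F` is where finite sets of sections are needed. Finitely many sections
-- of `F` have images in `M` that lift locally to a single `X i`, so they lift themselves to the
-- single module `D i`. Linear combinations are formed there. Transport is linear, so the result
-- does not depend on the lift, and it glues (`exists_sheafOfModules_glue`). The resulting module
-- over `M` has the given descent datum (`exists_glued_over`).

universe t w

/-! ### Base change of slice categories and its coherence. -/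

namespace CategoryTheory.Over

open Limits

variable {𝒮 : Type u₁} [Category.{v₁} 𝒮] [HasPullbacks 𝒮]

/-- The projection to `Z` of the base change of `Z` along `f`. -/
noncomputable def proj {X Y : 𝒮} (f : X ⟶ Y) (Z : Over Y) :
    ((Over.pullback f).obj Z).left ⟶ Z.left :=
  pullback.fst Z.hom f

lemma isPullback_proj {X Y : 𝒮} (f : X ⟶ Y) (Z : Over Y) :
    IsPullback (proj f Z) ((Over.pullback f).obj Z).hom Z.hom f :=
  IsPullback.of_hasPullback _ _

lemma proj_hom {X Y : 𝒮} (f : X ⟶ Y) (Z : Over Y) :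
    proj f Z ≫ Z.hom = ((Over.pullback f).obj Z).hom ≫ f :=
  (isPullback_proj f Z).w

lemma pullback_hom_ext {X Y : 𝒮} {f : X ⟶ Y} {Z : Over Y} {W : Over X}
    {a b : W ⟶ (Over.pullback f).obj Z} (h : a.left ≫ proj f Z = b.left ≫ proj f Z) : a = b := by
  ext
  exact (isPullback_proj f Z).hom_ext h ((Over.w a).trans (Over.w b).symm)

lemma pullback_map_proj {X Y : 𝒮} (f : X ⟶ Y) {Z Z' : Over Y} (a : Z ⟶ Z') :
    ((Over.pullback f).map a).left ≫ proj f Z' = proj f Z ≫ a.left :=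
  pullback.lift_fst _ _ _

lemma pullback_map_proj_assoc {X Y : 𝒮} (f : X ⟶ Y) {Z Z' : Over Y} (a : Z ⟶ Z') {T : 𝒮}
    (b : Z'.left ⟶ T) :
    ((Over.pullback f).map a).left ≫ proj f Z' ≫ b = proj f Z ≫ a.left ≫ b := by
  rw [← Category.assoc, pullback_map_proj, Category.assoc]

/-- The map over `X` into a base change given by a map over `f`. -/
noncomputable def pullbackLift {X Y : 𝒮} {f : X ⟶ Y} {Z : Over Y} {W : Over X} (a : W.left ⟶ Z.left)
    (h : a ≫ Z.hom = W.hom ≫ f) : W ⟶ (Over.pullback f).obj Z :=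
  Over.homMk ((isPullback_proj f Z).lift a W.hom h) ((isPullback_proj f Z).lift_snd _ _ _)

@[simp]
lemma pullbackLift_proj {X Y : 𝒮} {f : X ⟶ Y} {Z : Over Y} {W : Over X} (a : W.left ⟶ Z.left)
    (h : a ≫ Z.hom = W.hom ≫ f) : (pullbackLift a h).left ≫ proj f Z = a :=
  (isPullback_proj f Z).lift_fst _ _ _

@[simp]
lemma pullbackLift_proj_assoc {X Y : 𝒮} {f : X ⟶ Y} {Z : Over Y} {W : Over X}
    (a : W.left ⟶ Z.left) (h : a ≫ Z.hom = W.hom ≫ f) {T : 𝒮} (b : Z.left ⟶ T) :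
    (pullbackLift a h).left ≫ proj f Z ≫ b = a ≫ b := by
  rw [← Category.assoc, pullbackLift_proj]

/-- Base change along an identity, on objects. -/
noncomputable def pullbackIdObjIso {X : 𝒮} (Z : Over X) : (Over.pullback (𝟙 X)).obj Z ≅ Z where
  hom := Over.homMk (proj (𝟙 X) Z) (by rw [proj_hom, Category.comp_id])
  inv := pullbackLift (𝟙 _) (by simp)
  hom_inv_id := pullback_hom_ext (by simp)
  inv_hom_id := by ext; simp

/-- Base change along an identity is the identity. -/
noncomputable def pullbackIdIso (X : 𝒮) : Over.pullback (𝟙 X) ≅ 𝟭 (Over X) :=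
  NatIso.ofComponents pullbackIdObjIso (fun a ↦ by ext; exact pullback_map_proj _ a)

/-- The projection from a base change along `f ≫ g` to the base change along `g`, over `f`. -/
noncomputable def pullbackCompProj {X Y Z : 𝒮} (f : X ⟶ Y) (g : Y ⟶ Z) (W : Over Z) :
    Over.mk (((Over.pullback (f ≫ g)).obj W).hom ≫ f) ⟶ (Over.pullback g).obj W :=
  pullbackLift (proj (f ≫ g) W) ((proj_hom _ _).trans (Category.assoc _ _ _).symm)

lemma pullbackCompProj_hom {X Y Z : 𝒮} (f : X ⟶ Y) (g : Y ⟶ Z) (W : Over Z) :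
    (pullbackCompProj f g W).left ≫ ((Over.pullback g).obj W).hom =
      ((Over.pullback (f ≫ g)).obj W).hom ≫ f :=
  Over.w (pullbackCompProj f g W)

lemma pullbackCompProj_proj {X Y Z : 𝒮} (f : X ⟶ Y) (g : Y ⟶ Z) (W : Over Z) :
    (pullbackCompProj f g W).left ≫ proj g W = proj (f ≫ g) W :=
  pullbackLift_proj _ _

/-- Base change along a composition, on objects. -/
noncomputable def pullbackCompObjIso {X Y Z : 𝒮} (f : X ⟶ Y) (g : Y ⟶ Z) (W : Over Z) :
    (Over.pullback (f ≫ g)).obj W ≅ (Over.pullback f).obj ((Over.pullback g).obj W) where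
  hom := pullbackLift (pullbackCompProj f g W).left (pullbackCompProj_hom _ _ _)
  inv := pullbackLift (proj f _ ≫ proj g W) (by
    rw [Category.assoc, proj_hom, ← Category.assoc, proj_hom, Category.assoc])
  hom_inv_id := pullback_hom_ext (by simp [pullbackCompProj_proj])
  inv_hom_id := pullback_hom_ext (by
    rw [Over.comp_left, Category.assoc, pullbackLift_proj, Over.id_left, Category.id_comp]
    refine (isPullback_proj g W).hom_ext (by simp [pullbackCompProj_proj]) ?_
    rw [Category.assoc, pullbackCompProj_hom]
    exact (Category.assoc _ _ _).symm.trans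
      ((congrArg (· ≫ f) (Over.w (pullbackLift _ _))).trans (proj_hom f _).symm))

lemma pullbackCompObjIso_hom_proj_proj {X Y Z : 𝒮} (f : X ⟶ Y) (g : Y ⟶ Z) (W : Over Z) :
    (pullbackCompObjIso f g W).hom.left ≫ proj f _ ≫ proj g W = proj (f ≫ g) W := by
  simp [pullbackCompObjIso, pullbackCompProj_proj]

lemma pullbackCompObjIso_inv_proj {X Y Z : 𝒮} (f : X ⟶ Y) (g : Y ⟶ Z) (W : Over Z) :
    (pullbackCompObjIso f g W).inv.left ≫ proj (f ≫ g) W = proj f _ ≫ proj g W := by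
  simp [pullbackCompObjIso]

lemma pullbackCompObjIso_inv_proj_assoc {X Y Z : 𝒮} (f : X ⟶ Y) (g : Y ⟶ Z) (W : Over Z) {T : 𝒮}
    (b : W.left ⟶ T) : (pullbackCompObjIso f g W).inv.left ≫ proj (f ≫ g) W ≫ b =
      proj f _ ≫ proj g W ≫ b := by
  rw [← Category.assoc, pullbackCompObjIso_inv_proj, Category.assoc]

/-- An iterated base change is a base change along the composite, so its single projection to `W`
detects maps over `X`. -/
lemma pullback_pullback_hom_ext {X Y Z : 𝒮} {f : X ⟶ Y} {g : Y ⟶ Z} {W : Over Z} {V : Over X}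
    {a b : V ⟶ (Over.pullback f).obj ((Over.pullback g).obj W)}
    (h : a.left ≫ proj f _ ≫ proj g W = b.left ≫ proj f _ ≫ proj g W) : a = b := by
  rw [← cancel_mono (pullbackCompObjIso f g W).inv]
  apply pullback_hom_ext
  simpa [pullbackCompObjIso_inv_proj] using h

/-- Base change along a composition is the composition of the base changes. -/
noncomputable def pullbackCompIso {X Y Z : 𝒮} (f : X ⟶ Y) (g : Y ⟶ Z) :
    Over.pullback (f ≫ g) ≅ Over.pullback g ⋙ Over.pullback f :=
  NatIso.ofComponents (pullbackCompObjIso f g) (fun {V W} a ↦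
    pullback_pullback_hom_ext (X := X) (Y := Y) (Z := Z) (f := f) (g := g) (W := W)
    (V := (Over.pullback (f ≫ g)).obj V)
    (a := (Over.pullback (f ≫ g)).map a ≫ (pullbackCompObjIso f g W).hom)
    (b := (pullbackCompObjIso f g V).hom ≫ (Over.pullback f).map ((Over.pullback g).map a)) (by
      rw [Over.comp_left, Over.comp_left, Category.assoc, Category.assoc,
        pullbackCompObjIso_hom_proj_proj, pullback_map_proj, pullback_map_proj_assoc,
        pullback_map_proj, ← pullbackCompObjIso_hom_proj_proj]
      simp only [Category.assoc]))

lemma eqToHom_pullback_proj {X Y : 𝒮} {f g : X ⟶ Y} (h : f = g) (W : Over Y)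
    (h' : (Over.pullback f).obj W = (Over.pullback g).obj W) :
    (eqToHom h').left ≫ proj g W = proj f W := by
  subst h
  simp

/-- Every factor is compatible with the projections to `W`, and a map over the base into a base
change is determined by its projection. The two unit laws below hold for the same reason. -/
lemma pullbackCompObjIso_assoc {X Y Z T : 𝒮} (f : X ⟶ Y) (g : Y ⟶ Z) (h : Z ⟶ T) (W : Over T) :
    (pullbackCompObjIso f (g ≫ h) W).hom ≫
      (Over.pullback f).map (pullbackCompObjIso g h W).hom ≫
        (pullbackCompObjIso f g ((Over.pullback h).obj W)).inv ≫
          (pullbackCompObjIso (f ≫ g) h W).inv =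
      eqToHom (congr((Over.pullback $((Category.assoc f g h).symm)).obj W)) := by
  refine pullback_hom_ext ?_
  simp only [Over.comp_left, Category.assoc, pullbackCompObjIso_inv_proj,
    pullbackCompObjIso_inv_proj_assoc, pullback_map_proj_assoc, pullbackCompObjIso_hom_proj_proj]
  rw [eqToHom_pullback_proj (Category.assoc f g h).symm]

lemma pullbackCompObjIso_id_right {X Y : 𝒮} (f : X ⟶ Y) (W : Over Y) :
    (pullbackCompObjIso f (𝟙 Y) W).hom ≫ (Over.pullback f).map (pullbackIdObjIso W).hom =
      eqToHom (congr((Over.pullback $(Category.comp_id f)).obj W)) := by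
  refine pullback_hom_ext ?_
  rw [Over.comp_left, Category.assoc, pullback_map_proj]
  exact (pullbackCompObjIso_hom_proj_proj f (𝟙 Y) W).trans
    (eqToHom_pullback_proj (Category.comp_id f) W _).symm

lemma pullbackCompObjIso_id_left {X Y : 𝒮} (f : X ⟶ Y) (W : Over Y) :
    (pullbackCompObjIso (𝟙 X) f W).hom ≫ (pullbackIdObjIso ((Over.pullback f).obj W)).hom =
      eqToHom (congr((Over.pullback $(Category.id_comp f)).obj W)) := by
  refine pullback_hom_ext ?_
  rw [Over.comp_left, Category.assoc]
  exact (pullbackCompObjIso_hom_proj_proj (𝟙 X) f W).trans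
    (eqToHom_pullback_proj (Category.id_comp f) W _).symm

end CategoryTheory.Over

/-! ### The pseudofunctor of slice categories. -/

namespace CategoryTheory

open Limits Over

variable (𝒮 : Type u₁) [Category.{v₁} 𝒮] [HasPullbacks 𝒮]

lemma toCatHom_eqToHom_app {C D : Type u₂} [Category.{v₂} C] [Category.{v₂} D] {F G : C ⥤ D}
    (h : F.toCatHom = G.toCatHom) (X : C) (h' : F.obj X = G.obj X) :
    (eqToHom h).toNatTrans.app X = eqToHom h' := by
  obtain rfl : F = G := congrArg Cat.Hom.toFunctor h
  rfl

/-- The pseudofunctor of slice categories, with base change as restriction. -/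
noncomputable def overPseudofunctor :
    Pseudofunctor (LocallyDiscrete 𝒮ᵒᵖ) Cat.{v₁, max u₁ v₁} :=
  LocallyDiscrete.mkPseudofunctor
    (fun X ↦ Cat.of (Over X.unop))
    (fun f ↦ (Over.pullback f.unop).toCatHom)
    (fun X ↦ Cat.Hom.isoMk (pullbackIdIso X.unop))
    (fun f g ↦ Cat.Hom.isoMk (pullbackCompIso g.unop f.unop))
    (fun f g h ↦ by
      refine Cat.Hom₂.ext (NatTrans.ext (funext fun W ↦ ?_))
      refine Eq.trans ?_ ((pullbackCompObjIso_assoc h.unop g.unop f.unop W).trans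
        (toCatHom_eqToHom_app _ _ _).symm)
      -- The only extra factor is a component of an associator of `Cat`, which is an identity.
      exact congrArg (_ ≫ ·) (congrArg (_ ≫ ·) (Category.id_comp _)))
    (fun f ↦ by
      refine Cat.Hom₂.ext (NatTrans.ext (funext fun W ↦ ?_))
      refine Eq.trans ?_ ((pullbackCompObjIso_id_right f.unop W).trans
        (toCatHom_eqToHom_app _ _ _).symm)
      exact congrArg (_ ≫ ·) (Category.comp_id _))
    (fun f ↦ by
      refine Cat.Hom₂.ext (NatTrans.ext (funext fun W ↦ ?_))
      refine Eq.trans ?_ ((pullbackCompObjIso_id_left f.unop W).trans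
        (toCatHom_eqToHom_app _ _ _).symm)
      exact congrArg (_ ≫ ·) (Category.comp_id _))

variable {𝒮}

lemma overPseudofunctor_mapComp'_hom_proj_proj {X Y Z : 𝒮} (f : X ⟶ Y) (g : Y ⟶ Z) (k : X ⟶ Z)
    (h : g.op.toLoc ≫ f.op.toLoc = k.op.toLoc) (W : Over Z) :
    CommaMorphism.left (X := (Over.pullback k).obj W) (Y := (Over.pullback f).obj ((Over.pullback g).obj W))
      (((overPseudofunctor 𝒮).mapComp' g.op.toLoc f.op.toLoc k.op.toLoc h).hom.toNatTrans.app W)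
      ≫ proj f _ ≫ proj g W = proj k W := by
  obtain rfl : k = f ≫ g := Quiver.Hom.op_inj (congrArg Discrete.as h).symm
  have := (overPseudofunctor 𝒮).mapComp'_eq_mapComp g.op.toLoc f.op.toLoc
  erw [this]
  exact pullbackCompObjIso_hom_proj_proj f g W

lemma overPseudofunctor_mapComp'_inv_proj {X Y Z : 𝒮} (f : X ⟶ Y) (g : Y ⟶ Z) (k : X ⟶ Z)
    (h : g.op.toLoc ≫ f.op.toLoc = k.op.toLoc) (W : Over Z) :
    CommaMorphism.left (X := (Over.pullback f).obj ((Over.pullback g).obj W)) (Y := (Over.pullback k).obj W)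
      (((overPseudofunctor 𝒮).mapComp' g.op.toLoc f.op.toLoc k.op.toLoc h).inv.toNatTrans.app W)
      ≫ proj k _  = proj f _ ≫ proj g W := by
  obtain rfl : k = f ≫ g := Quiver.Hom.op_inj (congrArg Discrete.as h).symm
  have := (overPseudofunctor 𝒮).mapComp'_eq_mapComp g.op.toLoc f.op.toLoc
  erw [this]
  exact pullbackCompObjIso_inv_proj f g W

end CategoryTheory

/-! ### The codomain fibration as the total category of the slices. -/

namespace CategoryTheory

open Limits Over

variable {𝒮 : Type u₁} [Category.{v₁} 𝒮] [HasPullbacks 𝒮]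

/-- The cartesian lifts are the fibre product squares. -/
instance isFibered_arrowRightFunc : (Arrow.rightFunc : Arrow 𝒮 ⥤ 𝒮).IsFibered :=
  Functor.IsFibered.of_exists_isStronglyCartesian fun a R (f : R ⟶ a.right) ↦ by
    let φ : Arrow.mk (pullback.snd a.hom f) ⟶ a :=
      Arrow.homMk (pullback.fst a.hom f) f pullback.condition
    have hφ : (Arrow.rightFunc (C := 𝒮)).IsHomLift f φ := IsHomLift.map Arrow.rightFunc φ
    refine ⟨_, φ, @Functor.IsStronglyCartesian.mk _ _ _ _ _ _ _ _ _ _ _ hφ fun {a'} (g : a'.right ⟶ R) φ' hφ' ↦ ?_⟩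
    have hr : φ'.right = g ≫ f :=
      (@IsHomLift.fac' _ _ _ _ _ _ _ _ _ _ _ hφ').trans
        ((Category.id_comp _).trans (Category.comp_id _))
    have hw : φ'.left ≫ a.hom = (a'.hom ≫ g) ≫ f := by
      rw [Category.assoc, ← hr]
      exact Arrow.w φ'
    let χ : a' ⟶ Arrow.mk (pullback.snd a.hom f) :=
      Arrow.homMk (pullback.lift φ'.left (a'.hom ≫ g) hw) g (pullback.lift_snd _ _ _)
    refine ⟨χ, ⟨IsHomLift.map Arrow.rightFunc χ, ?_⟩, ?_⟩
    · ext
      · exact pullback.lift_fst _ _ _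
      · exact hr.symm
    · rintro ψ ⟨hψ, rfl⟩
      have hg : ψ.right = g :=
        (@IsHomLift.fac' _ _ _ _ _ _ _ _ _ _ _ hψ).trans
          ((Category.id_comp _).trans (Category.comp_id _))
      ext
      · refine pullback.hom_ext (pullback.lift_fst _ _ _).symm ((Arrow.w ψ).trans ?_)
        refine Eq.trans ?_ (pullback.lift_snd _ _ _).symm
        rw [hg]
      · exact hg

namespace CoGrothendieckOver

/-- The map between total objects underlying a map in the Grothendieck construction of
`overPseudofunctor`. -/
noncomputable def total {x y : (overPseudofunctor 𝒮).CoGrothendieck} (φ : x ⟶ y) :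
    Over.left (X := x.base) x.fiber ⟶ Over.left (X := y.base) y.fiber :=
  Over.Hom.left (f := x.fiber) (g := (Over.pullback φ.base).obj y.fiber) φ.fiber ≫
    proj φ.base y.fiber

lemma total_hom {x y : (overPseudofunctor 𝒮).CoGrothendieck} (φ : x ⟶ y) :
    total φ ≫ Over.hom (X := y.base) y.fiber = Over.hom (X := x.base) x.fiber ≫ φ.base :=
  have h (W Z : Over _) (a : W ⟶ (Over.pullback φ.base).obj Z) :
      (a.left ≫ proj φ.base Z) ≫ Z.hom = W.hom ≫ φ.base := by
    rw [Category.assoc, proj_hom, Over.w_assoc]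
  h x.fiber y.fiber φ.fiber

variable (𝒮) in
/-- The functor from the Grothendieck construction of `overPseudofunctor` to arrows. -/
noncomputable def toArrow : (overPseudofunctor 𝒮).CoGrothendieck ⥤ Arrow 𝒮 where
  obj x := Arrow.mk (Over.hom (X := x.base) x.fiber)
  map φ := Arrow.homMk (total φ) φ.base (total_hom φ)
  map_id x := by
    ext
    · exact pullbackLift_proj (f := 𝟙 x.base) (Z := x.fiber) (W := x.fiber) _ _
    · rfl
  map_comp {x y z} φ ψ := by
    ext
    · refine (Category.assoc _ _ _).trans ((congrArg (_ ≫ ·) ((Category.assoc _ _ _).trans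
        (congrArg (_ ≫ ·) (pullbackCompObjIso_inv_proj φ.base ψ.base z.fiber)))).trans ?_)
      have := pullback_map_proj_assoc φ.base (Z := y.fiber) (Z' := (Over.pullback ψ.base).obj z.fiber)
        ψ.fiber (proj ψ.base z.fiber)
      exact (congrArg (_ ≫ ·) this).trans (Category.assoc _ _ _).symm
    · rfl

instance : (toArrow 𝒮).Faithful where
  map_injective {x y} φ ψ h := by
    obtain ⟨b, f⟩ := φ
    obtain ⟨b', f'⟩ := ψ
    obtain rfl : b = b' := congrArg Arrow.Hom.right h
    congr 1
    exact pullback_hom_ext (W := x.fiber) (f := b) (Z := y.fiber) (congrArg Arrow.Hom.left h)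

instance : (toArrow 𝒮).Full where
  map_surjective {x y} φ := by
    refine ⟨⟨φ.right, pullbackLift (f := φ.right) (Z := y.fiber) (W := x.fiber) φ.left
      (Arrow.w φ)⟩, ?_⟩
    ext
    · exact pullbackLift_proj _ _
    · rfl

instance : (toArrow 𝒮).EssSurj where
  mem_essImage a := ⟨⟨a.right, Over.mk a.hom⟩, ⟨Iso.refl _⟩⟩

instance : (toArrow 𝒮).IsEquivalence where

variable (𝒮) in
lemma exists_equivalence_arrow :
    ∃ e : Arrow 𝒮 ≌ (overPseudofunctor 𝒮).CoGrothendieck,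
      Nonempty (e.functor ⋙ Pseudofunctor.CoGrothendieck.forget _ ≅ Arrow.rightFunc) :=
  let E := (toArrow 𝒮).asEquivalence
  ⟨E.symm, ⟨Functor.isoWhiskerRight E.counitIso Arrow.rightFunc⟩⟩

end CoGrothendieckOver

end CategoryTheory

/-! ### Descent data for slices as transport of generalized elements; descent of morphisms. -/

namespace CategoryTheory

open Limits Over

variable {𝒮 : Type u₁} [Category.{v₁} 𝒮] [HasPullbacks 𝒮]

namespace Over

/-- The map over `g` between base changes along `g ≫ f` and along `f`. -/
noncomputable def projOver {X Y Z : 𝒮} (f : X ⟶ Y) (g : Y ⟶ Z) (k : X ⟶ Z) (h : f ≫ g = k)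
    (W : Over Z) : ((Over.pullback k).obj W).left ⟶ ((Over.pullback g).obj W).left :=
  (isPullback_proj g W).lift (proj k W) (((Over.pullback k).obj W).hom ≫ f) (by
    rw [proj_hom, Category.assoc, h])

@[simp]
lemma projOver_proj {X Y Z : 𝒮} (f : X ⟶ Y) (g : Y ⟶ Z) (k : X ⟶ Z) (h : f ≫ g = k)
    (W : Over Z) : projOver f g k h W ≫ proj g W = proj k W :=
  (isPullback_proj g W).lift_fst _ _ _

@[simp]
lemma projOver_hom {X Y Z : 𝒮} (f : X ⟶ Y) (g : Y ⟶ Z) (k : X ⟶ Z) (h : f ≫ g = k)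
    (W : Over Z) :
    projOver f g k h W ≫ ((Over.pullback g).obj W).hom = ((Over.pullback k).obj W).hom ≫ f :=
  (isPullback_proj g W).lift_snd _ _ _

end Over

-- Removes the coherence isomorphisms hidden in `pullHom`: after projection to `M₂`, pulling back a
-- gluing map is precomposition with the canonical map of base changes.
open Pseudofunctor.LocallyDiscreteOpToCat in
lemma overPseudofunctor_pullHom_proj {X₁ X₂ Y Y' : 𝒮} {M₁ : Over X₁} {M₂ : Over X₂}
    {f₁ : Y ⟶ X₁} {f₂ : Y ⟶ X₂} (φ : (Over.pullback f₁).obj M₁ ⟶ (Over.pullback f₂).obj M₂)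
    (g : Y' ⟶ Y) (gf₁ : Y' ⟶ X₁) (gf₂ : Y' ⟶ X₂) (h₁ : g ≫ f₁ = gf₁) (h₂ : g ≫ f₂ = gf₂)
    (ψ : (Over.pullback gf₁).obj M₁ ⟶ (Over.pullback gf₂).obj M₂)
    (h : ψ = pullHom (F := overPseudofunctor 𝒮) (M₁ := M₁) (M₂ := M₂) φ g gf₁ gf₂ h₁ h₂) :
    ψ.left ≫ proj gf₂ M₂ = projOver g f₁ gf₁ h₁ M₁ ≫ φ.left ≫ proj f₂ M₂ := by
  subst h₁ h₂
  have : ψ = (pullbackCompObjIso g f₁ M₁).hom ≫ (Over.pullback g).map φ ≫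
      (pullbackCompObjIso g f₂ M₂).inv := by
    rw [h]
    dsimp only [pullHom]
    have h₁ := (overPseudofunctor 𝒮).mapComp'_eq_mapComp f₁.op.toLoc g.op.toLoc
    have h₂ := (overPseudofunctor 𝒮).mapComp'_eq_mapComp f₂.op.toLoc g.op.toLoc
    erw [h₁, h₂]
    rfl
  rw [this]
  simp only [Over.comp_left, Category.assoc, pullbackCompObjIso_inv_proj,
    pullback_map_proj_assoc]
  simp only [← Category.assoc]
  congr 2
  refine (isPullback_proj f₁ M₁).hom_ext ?_ ?_
  · simp [pullbackCompObjIso_hom_proj_proj]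
  · rw [Category.assoc, proj_hom, Over.w_assoc, projOver_hom]

namespace OverDescent

variable {ι : Type t} {S : 𝒮} {X : ι → 𝒮} {f : ∀ i, X i ⟶ S}
  (D : (overPseudofunctor 𝒮).DescentData f)

/-- The objects of a descent datum for slice categories. -/
def obj (i : ι) : Over (X i) := D.obj i

/-- The gluing maps of a descent datum for slice categories. -/
noncomputable def hom {Y : 𝒮} (q : Y ⟶ S) {i j : ι} (a : Y ⟶ X i) (b : Y ⟶ X j) (ha : a ≫ f i = q)
    (hb : b ≫ f j = q) : (Over.pullback a).obj (obj D i) ⟶ (Over.pullback b).obj (obj D j) :=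
  D.hom q a b ha hb

lemma hom_self {Y : 𝒮} (q : Y ⟶ S) {i : ι} (a : Y ⟶ X i) (ha : a ≫ f i = q) :
    hom D q a a ha ha = 𝟙 _ :=
  D.hom_self q a ha

lemma hom_comp {Y : 𝒮} (q : Y ⟶ S) {i j k : ι} (a : Y ⟶ X i) (b : Y ⟶ X j) (c : Y ⟶ X k)
    (ha : a ≫ f i = q) (hb : b ≫ f j = q) (hc : c ≫ f k = q) :
    hom D q a b ha hb ≫ hom D q b c hb hc = hom D q a c ha hc :=
  D.hom_comp q a b c ha hb hc

lemma hom_proj {Y Y' : 𝒮} (g : Y' ⟶ Y) (q : Y ⟶ S) {i j : ι} (a : Y ⟶ X i) (b : Y ⟶ X j)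
    (ha : a ≫ f i = q) (hb : b ≫ f j = q) (q' : Y' ⟶ S) (a' : Y' ⟶ X i) (b' : Y' ⟶ X j)
    (ha' : a' ≫ f i = q') (hb' : b' ≫ f j = q') (h₁ : g ≫ a = a') (h₂ : g ≫ b = b') :
    (hom D q' a' b' ha' hb').left ≫ proj b' (obj D j) =
      projOver g a a' h₁ _ ≫ (hom D q a b ha hb).left ≫ proj b _ :=
  overPseudofunctor_pullHom_proj _ g a' b' h₁ h₂ _
    (D.pullHom_hom g q q' (by rw [← ha, ← ha', ← h₁, Category.assoc]) a b ha hb a' b' h₁ h₂).symm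

/-- The transport of a generalized element `a` of `obj D i` to a generalized element of
`obj D j` over `b`. -/
noncomputable def tr {W : 𝒮} {i j : ι} (a : W ⟶ (obj D i).left) (b : W ⟶ X j)
    (h : a ≫ (obj D i).hom ≫ f i = b ≫ f j) : W ⟶ (obj D j).left :=
  (pullbackLift (f := a ≫ (obj D i).hom) (W := Over.mk (𝟙 W)) (Z := obj D i) a
    (by simp)).left ≫
    (hom D (b ≫ f j) (a ≫ (obj D i).hom) b ((Category.assoc _ _ _).trans h) rfl).left ≫
      proj b (obj D j)

lemma tr_hom {W : 𝒮} {i j : ι} (a : W ⟶ (obj D i).left) (b : W ⟶ X j)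
    (h : a ≫ (obj D i).hom ≫ f i = b ≫ f j) : tr D a b h ≫ (obj D j).hom = b := by
  rw [tr, Category.assoc, Category.assoc, proj_hom, Over.w_assoc, Over.w_assoc]
  exact Category.id_comp b

/-- The definition of `tr` uses the gluing map over `W` itself. Gluing maps are stable under
pullback, so the one over any `Y` through which the situation factors gives the same result. -/
lemma tr_eq {W Y : 𝒮} {i j : ι} (a : W ⟶ (obj D i).left) (b : W ⟶ X j)
    (h : a ≫ (obj D i).hom ≫ f i = b ≫ f j) (q : Y ⟶ S) (c : Y ⟶ X i) (d : Y ⟶ X j)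
    (hc : c ≫ f i = q) (hd : d ≫ f j = q) (s : W ⟶ ((Over.pullback c).obj (obj D i)).left)
    (hsa : s ≫ proj c _ = a) (hsb : s ≫ ((Over.pullback c).obj (obj D i)).hom ≫ d = b) :
    tr D a b h = s ≫ (hom D q c d hc hd).left ≫ proj d _ := by
  rw [tr, hom_proj D (s ≫ ((Over.pullback c).obj (obj D i)).hom) q c d hc hd _ _ _ _ _
    (by rw [← hsa, Category.assoc, Category.assoc, proj_hom])
    (by rw [← hsb, Category.assoc]), ← Category.assoc]
  congr 1
  refine (isPullback_proj c _).hom_ext ?_ ?_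
  · rw [Category.assoc, projOver_proj, pullbackLift_proj, hsa]
  · rw [Category.assoc, projOver_hom, Over.w_assoc]
    exact Category.id_comp _

lemma comp_tr {W W' : 𝒮} (g : W' ⟶ W) {i j : ι} (a : W ⟶ (obj D i).left) (b : W ⟶ X j)
    (h : a ≫ (obj D i).hom ≫ f i = b ≫ f j) :
    tr D (g ≫ a) (g ≫ b) (by rw [Category.assoc, Category.assoc, h]) = g ≫ tr D a b h := by
  rw [tr_eq D (g ≫ a) (g ≫ b) _ (b ≫ f j) (a ≫ (obj D i).hom) b
    ((Category.assoc _ _ _).trans h) rfl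
    (g ≫ (pullbackLift (f := a ≫ (obj D i).hom) (W := Over.mk (𝟙 W)) (Z := obj D i) a
    (by simp)).left) (by simp) (by
      rw [Category.assoc, Over.w_assoc]
      exact congrArg (g ≫ ·) (Category.id_comp b)), tr, Category.assoc]

lemma tr_self {W : 𝒮} {i : ι} (a : W ⟶ (obj D i).left) :
    tr D a (a ≫ (obj D i).hom) (Category.assoc _ _ _).symm = a := by
  rw [tr, hom_self, Over.id_left, Category.id_comp, pullbackLift_proj]

/-- This is the cocycle condition `hom_comp`, expressed on generalized elements. -/
lemma tr_tr {W : 𝒮} {i j k : ι} (a : W ⟶ (obj D i).left) (b : W ⟶ X j) (c : W ⟶ X k)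
    (h : a ≫ (obj D i).hom ≫ f i = b ≫ f j) (h' : b ≫ f j = c ≫ f k) :
    tr D (tr D a b h) c (by rw [← Category.assoc, tr_hom, h']) = tr D a c (h.trans h') := by
  let s := (pullbackLift (f := a ≫ (obj D i).hom) (W := Over.mk (𝟙 W)) (Z := obj D i) a
    (by simp)).left
  rw [tr_eq D (tr D a b h) c _ (b ≫ f j) b c rfl h'.symm
    (s ≫ (hom D (b ≫ f j) (a ≫ (obj D i).hom) b ((Category.assoc _ _ _).trans h) rfl).left)
    (by rw [tr, Category.assoc]) (by
      rw [Category.assoc, Over.w_assoc, Over.w_assoc]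
      exact Category.id_comp c),
    tr_eq D a c _ (b ≫ f j) (a ≫ (obj D i).hom) c ((Category.assoc _ _ _).trans h) h'.symm s
      (pullbackLift_proj _ _) (by
      rw [Over.w_assoc]
      exact Category.id_comp c), Category.assoc,
    ← hom_comp D _ _ b c ((Category.assoc _ _ _).trans h) rfl h'.symm, Over.comp_left]
  simp only [Category.assoc]

/-- The components of a morphism of descent data for slice categories. -/
def mapHom {D D' : (overPseudofunctor 𝒮).DescentData f} (g : D ⟶ D') (i : ι) :
    obj D i ⟶ obj D' i :=
  g.hom i

lemma tr_map {D D' : (overPseudofunctor 𝒮).DescentData f} (g : D ⟶ D') {W : 𝒮} {i j : ι}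
    (a : W ⟶ (obj D i).left) (b : W ⟶ X j) (h : a ≫ (obj D i).hom ≫ f i = b ≫ f j) :
    tr D a b h ≫ (mapHom g j).left =
      tr D' (a ≫ (mapHom g i).left) b (by rw [Category.assoc, Over.w_assoc, h]) := by
  have hc : (Over.pullback (a ≫ (obj D i).hom)).map (mapHom g i) ≫
      hom D' (b ≫ f j) (a ≫ (obj D i).hom) b ((Category.assoc _ _ _).trans h) rfl =
      hom D (b ≫ f j) (a ≫ (obj D i).hom) b ((Category.assoc _ _ _).trans h) rfl ≫
        (Over.pullback b).map (mapHom g j) :=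
    g.comm (b ≫ f j) (a ≫ (obj D i).hom) b ((Category.assoc _ _ _).trans h) rfl
  have hc' := congrArg (fun k ↦ (pullbackLift (f := a ≫ (obj D i).hom) (W := Over.mk (𝟙 W))
    (Z := obj D i) a (by simp)).left ≫ k.left ≫ proj b _) hc
  simp only [Over.comp_left, Category.assoc, pullback_map_proj] at hc'
  rw [tr, Category.assoc, Category.assoc, ← hc', tr_eq D' _ b _ (b ≫ f j) (a ≫ (obj D i).hom) b
    ((Category.assoc _ _ _).trans h) rfl ((pullbackLift (f := a ≫ (obj D i).hom)
      (W := Over.mk (𝟙 W)) (Z := obj D i) a (by simp)).left ≫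
        ((Over.pullback (a ≫ (obj D i).hom)).map (mapHom g i)).left)]
  · exact (Category.assoc _ _ _).symm
  · rw [Category.assoc, pullback_map_proj, pullbackLift_proj_assoc]
  · rw [Category.assoc, Over.w_assoc, Over.w_assoc]
    exact Category.id_comp b

variable (f) in
lemma hom_toDescentData_proj_proj (E : Over S) {Y : 𝒮} (q : Y ⟶ S) {i j : ι} (a : Y ⟶ X i)
    (b : Y ⟶ X j) (ha : a ≫ f i = q) (hb : b ≫ f j = q) :
    (hom (((overPseudofunctor 𝒮).toDescentData f).obj E) q a b ha hb).left ≫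
      proj b _ ≫ proj (f j) E = proj a _ ≫ proj (f i) E := by
  have h₁ := overPseudofunctor_mapComp'_inv_proj a (f i) q
    (congrArg (fun k ↦ k.op.toLoc) ha) E
  have h₂ := overPseudofunctor_mapComp'_hom_proj_proj b (f j) q
    (congrArg (fun k ↦ k.op.toLoc) hb) E
  refine Eq.trans ?_ h₁
  rw [← h₂]
  exact Category.assoc _ _ _

/-- In the descent datum of an actual object `E`, transport leaves the underlying element of `E`
unchanged. -/
lemma tr_toDescentData_proj {E : Over S} {W : 𝒮} {i j : ι}
    (a : W ⟶ ((Over.pullback (f i)).obj E).left) (b : W ⟶ X j)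
    (h : a ≫ ((Over.pullback (f i)).obj E).hom ≫ f i = b ≫ f j) :
    tr (((overPseudofunctor 𝒮).toDescentData f).obj E) a b h ≫ proj (f j) E =
      a ≫ proj (f i) E := by
  refine (Category.assoc _ _ _).trans ((congrArg (_ ≫ ·) ((Category.assoc _ _ _).trans
    (hom_toDescentData_proj_proj f E _ _ b _ _))).trans ((Category.assoc _ _ _).symm.trans
      (congrArg (· ≫ proj (f i) E) (pullbackLift_proj _ _))))

lemma tr_toDescentData_eq {E : Over S} {W : 𝒮} {i j : ι}
    (a : W ⟶ ((Over.pullback (f i)).obj E).left) (b : W ⟶ ((Over.pullback (f j)).obj E).left)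
    (h : a ≫ proj (f i) E = b ≫ proj (f j) E) :
    tr (((overPseudofunctor 𝒮).toDescentData f).obj E) a
      (b ≫ ((Over.pullback (f j)).obj E).hom) (by
        have := congrArg (· ≫ E.hom) h
        simp only [Category.assoc, proj_hom] at this
        rw [Category.assoc]
        exact this) = b :=
  (isPullback_proj (f j) E).hom_ext ((tr_toDescentData_proj _ _ _).trans h) (tr_hom _ _ _ _)

/-- An isomorphism of descent data from a slice object whose base changes are identified with the
members of a descent datum, compatibly with transport. -/
lemma mem_essImage {E : Over S} (κ : ∀ i, (obj D i).left ⟶ E.left)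
    (hκ : ∀ i, IsPullback (κ i) (obj D i).hom E.hom (f i))
    (htr : ∀ ⦃W : 𝒮⦄ ⦃i j : ι⦄ (a : W ⟶ (obj D i).left) (b : W ⟶ X j)
      (h : a ≫ (obj D i).hom ≫ f i = b ≫ f j), tr D a b h ≫ κ j = a ≫ κ i) :
    ((overPseudofunctor 𝒮).toDescentData f).essImage D := by
  let e (i : ι) : obj D i ≅ (Over.pullback (f i)).obj E :=
    Over.isoMk ((hκ i).isoIsPullback _ _ (isPullback_proj (f i) E)) (by simp)
  have he (i : ι) : (e i).hom.left ≫ proj (f i) E = κ i := by simp [e]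
  refine ⟨E, ⟨(Pseudofunctor.DescentData.isoMk (D₁ := D)
    (D₂ := ((overPseudofunctor 𝒮).toDescentData f).obj E) e ?_).symm⟩⟩
  intro Y q i j a b ha hb
  refine pullback_pullback_hom_ext (f := b) (g := f j) (W := E)
    (V := (Over.pullback a).obj (obj D i))
    (a := (Over.pullback a).map (e i).hom ≫
      hom (((overPseudofunctor 𝒮).toDescentData f).obj E) q a b ha hb)
    (b := hom D q a b ha hb ≫ (Over.pullback b).map (e j).hom) ?_
  trans ((Over.pullback a).map (e i).hom).left ≫ proj a _ ≫ proj (f i) E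
  · exact (Category.assoc _ _ _).trans
      (congrArg (_ ≫ ·) (hom_toDescentData_proj_proj f E q a b ha hb))
  · rw [pullback_map_proj_assoc, he, Over.comp_left, Category.assoc, pullback_map_proj_assoc, he,
      ← htr (proj a (obj D i)) (((Over.pullback a).obj (obj D i)).hom ≫ b) (by
        rw [← Category.assoc, proj_hom, Category.assoc, Category.assoc, ha, hb]),
      tr_eq D _ _ _ q a b ha hb (𝟙 _) (Category.id_comp _) (Category.id_comp _),
      Category.id_comp, Category.assoc]

end OverDescent

/-- Morphisms of slice categories descend along covers of a subcanonical topology. -/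
lemma isPrestack_overPseudofunctor (J : GrothendieckTopology 𝒮) [J.Subcanonical] :
    (overPseudofunctor 𝒮).IsPrestack J := by
  refine .of_isPrestackFor fun S R hR ↦ ?_
  rw [Pseudofunctor.isPrestackFor_iff, Functor.FullyFaithful.nonempty_iff_map_bijective]
  intro (N : Over S) (P : Over S)
  let X (i : R.arrows.category) : 𝒮 := ((Over.pullback i.obj.hom).obj N).left
  let p (i : R.arrows.category) : X i ⟶ N.left := proj i.obj.hom N
  -- If `a ≫ N.hom` lies in `R`, then `a` factors through the base change of `N` along that very
  -- composite; hence the generated sieve contains the pullback of `R`.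
  have hp : Sieve.ofArrows X p ∈ J N.left := by
    refine J.superset_covering ?_ (J.pullback_stable N.hom hR)
    intro W a ha
    let i : R.arrows.category := ⟨Over.mk (a ≫ N.hom), ha⟩
    exact ⟨X i, (isPullback_proj i.obj.hom N).lift a (𝟙 W) (by simp [i]), p i, ⟨i⟩,
      (isPullback_proj i.obj.hom N).lift_fst _ _ _⟩
  have hP (Z : 𝒮) := (Presieve.isSheafFor_arrows_iff (yoneda.obj Z) p).1
    ((Presieve.isSheafFor_iff_generate _).2
      ((GrothendieckTopology.Subcanonical.isSheaf_of_isRepresentable (J := J)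
        (yoneda.obj Z)) _ hp))
  have hp_ext {Z : 𝒮} (a b : N.left ⟶ Z) (h : ∀ i, p i ≫ a = p i ≫ b) : a = b :=
    (hP Z (fun i ↦ p i ≫ a) (fun i j W c d hcd ↦ by
      simpa using congrArg (· ≫ a) hcd)).unique (fun _ ↦ rfl) (fun i ↦ (h i).symm)
  constructor
  · intro (φ : N ⟶ P) (ψ : N ⟶ P) h
    refine Over.OverMorphism.ext (hp_ext _ _ fun i ↦ ?_)
    have h' : (Over.pullback i.obj.hom).map φ = (Over.pullback i.obj.hom).map ψ :=
      congrArg (fun k ↦ Pseudofunctor.DescentData.Hom.hom k i) h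
    rw [← pullback_map_proj, ← pullback_map_proj, h']
  · intro g
    let g' (i : R.arrows.category) :
      (Over.pullback i.obj.hom).obj N ⟶ (Over.pullback i.obj.hom).obj P := OverDescent.mapHom g i
    -- Compatibility: if `a` and `b` have the same image in `N`, then `b` is the transport of `a`.
    -- The map `g` commutes with transport, and transport does not change the image in `P`.
    obtain ⟨φ, hφ, -⟩ := hP P.left (fun i ↦ (g' i).left ≫ proj i.obj.hom P)
        (fun i j Z a b hab ↦ by
      have h₀ : a ≫ ((Over.pullback i.obj.hom).obj N).hom ≫ i.obj.hom =
          (b ≫ ((Over.pullback j.obj.hom).obj N).hom) ≫ j.obj.hom := by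
        have := congrArg (· ≫ N.hom) hab
        simp only [p, Category.assoc, proj_hom] at this
        rw [this, Category.assoc]
      have h₁ := OverDescent.tr_map g a _ h₀
      have h₂ := OverDescent.tr_toDescentData_eq (f := fun i : R.arrows.category ↦ i.obj.hom) a b hab
      have h₃ : b ≫ (g' j).left = _ := (congrArg (· ≫ (g' j).left) h₂).symm.trans h₁
      change a ≫ (g' i).left ≫ proj i.obj.hom P = b ≫ (g' j).left ≫ proj j.obj.hom P
      rw [← Category.assoc, ← Category.assoc, h₃]
      exact (OverDescent.tr_toDescentData_proj (f := fun i : R.arrows.category ↦ i.obj.hom)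
        (E := P) (a ≫ (g' i).left) _ (by rw [Category.assoc, Over.w_assoc]; exact h₀)).symm)
    replace hφ (i : R.arrows.category) : p i ≫ φ = (g' i).left ≫ proj i.obj.hom P := hφ i
    refine ⟨Over.homMk (U := N) (V := P) φ (hp_ext _ _ fun i ↦ ?_), ?_⟩
    · rw [← Category.assoc, hφ, Category.assoc, proj_hom, Over.w_assoc]
      exact (proj_hom _ _).symm
    · refine Pseudofunctor.DescentData.hom_ext fun i ↦ ?_
      exact pullback_hom_ext (f := i.obj.hom) (Z := P) (W := (Over.pullback i.obj.hom).obj N)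
        ((pullback_map_proj i.obj.hom (Over.homMk (U := N) (V := P) φ _)).trans (hφ i))

/-- Slice categories form a stack for a subcanonical topology if all descent data are effective. -/
lemma isStack_overPseudofunctor (J : GrothendieckTopology 𝒮) [J.Subcanonical]
    (H : ∀ {S : 𝒮} (R : Sieve S) (_ : R ∈ J S)
      (D : (overPseudofunctor 𝒮).DescentData (fun i : R.arrows.category ↦ i.obj.hom)),
      ∃ (E : Over S) (κ : ∀ i, (OverDescent.obj D i).left ⟶ E.left),
        (∀ i, IsPullback (κ i) (OverDescent.obj D i).hom E.hom i.obj.hom) ∧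
        ∀ ⦃W : 𝒮⦄ ⦃i j : R.arrows.category⦄ (a : W ⟶ (OverDescent.obj D i).left)
          (b : W ⟶ j.obj.left) (h : a ≫ (OverDescent.obj D i).hom ≫ i.obj.hom = b ≫ j.obj.hom),
          OverDescent.tr D a b h ≫ κ j = a ≫ κ i) :
    (overPseudofunctor 𝒮).IsStack J where
  toIsPrestack := isPrestack_overPseudofunctor J
  essSurj_of_sieve R hR := ⟨fun D ↦ by
    obtain ⟨E, κ, hκ, htr⟩ := H R hR D
    exact OverDescent.mem_essImage D κ hκ htr⟩

end CategoryTheory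

/-! ### Gluing locally unique sections. -/

namespace CategoryTheory.Presieve

variable {C : Type u₁} [Category.{v₁} C] {J : GrothendieckTopology C} {F : Cᵒᵖ ⥤ Type w}

/-- A section of a sheaf that is locally characterized by a property exists globally. -/
lemma IsSheaf.exists_of_locally_unique (hF : IsSheaf J F) {U : C}
    (P : ∀ ⦃V : C⦄, (V ⟶ U) → F.obj (op V) → Prop)
    (hP : ∀ ⦃V W : C⦄ (h : W ⟶ V) (g : V ⟶ U) (s : F.obj (op V)), P g s → P (h ≫ g) (F.map h.op s))
    (hu : ∀ ⦃V : C⦄ (g : V ⟶ U) (s s' : F.obj (op V)), P g s → P g s' → s = s')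
    (T : Sieve U) (hT : T ∈ J U) (he : ∀ ⦃V : C⦄ (g : V ⟶ U), T g → ∃ s, P g s) :
    ∃ s : F.obj (op U), ∀ ⦃V : C⦄ (g : V ⟶ U) (s' : F.obj (op V)), P g s' → F.map g.op s = s' := by
  choose x hx using he
  have hc : FamilyOfElements.Compatible (P := F) (R := T.arrows) (fun V g hg ↦ x g hg) := by
    intro V₁ V₂ W g₁ g₂ f₁ f₂ h₁ h₂ e
    refine hu (g₁ ≫ f₁) _ _ (hP _ _ _ (hx f₁ h₁)) ?_
    rw [e]
    exact hP _ _ _ (hx f₂ h₂)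
  obtain ⟨s, hs, -⟩ := hF T hT _ hc
  refine ⟨s, fun V g s' hs' ↦ ?_⟩
  -- The arrow `g` need not belong to `T`, so the comparison is made on the pullback of `T` along
  -- `g`.
  refine (hF.isSeparated _ (J.pullback_stable g hT)).ext fun W h hh ↦ ?_
  have := hs (h ≫ g) hh
  rw [← Functor.map_comp_apply, ← op_comp, this]
  exact hu _ _ _ (hx _ _) (hP _ _ _ hs')

end CategoryTheory.Presieve

/-! ### Sections of sheaves of modules; subcanonicity of the topology. -/

namespace ModuleSite

open Limits

variable {C : Type u} [SmallCategory C] {J : GrothendieckTopology C} {A : Sheaf J RingCat.{u}}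

lemma mapSection_add {N M : SheafOfModules.{u} A} (f : N ⟶ M) {U : C} (s t : N.val.obj (op U)) :
    mapSection f (s + t) = mapSection f s + mapSection f t :=
  map_add (f.val.app (op U)).hom s t

lemma mapSection_smul {N M : SheafOfModules.{u} A} (f : N ⟶ M) {U : C} (a : A.obj.obj (op U))
    (s : N.val.obj (op U)) : mapSection f (a • s) = a • mapSection f s :=
  map_smul (f.val.app (op U)).hom a s

lemma restrict_add (M : SheafOfModules.{u} A) {U V : C} (g : V ⟶ U) (s t : M.val.obj (op U)) :
    restrict M g (s + t) = restrict M g s + restrict M g t :=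
  map_add (M.val.map g.op).hom s t

lemma restrict_smul (M : SheafOfModules.{u} A) {U V : C} (g : V ⟶ U) (a : A.obj.obj (op U))
    (s : M.val.obj (op U)) : restrict M g (a • s) = A.obj.map g.op a • restrict M g s :=
  M.val.map_smul g.op a s

/-- The underlying presheaf of sets of a sheaf of modules. -/
noncomputable def sectionsPresheaf (M : SheafOfModules.{u} A) : Cᵒᵖ ⥤ Type u :=
  M.val.presheaf ⋙ forget Ab

lemma isSheaf_sectionsPresheaf (M : SheafOfModules.{u} A) :
    Presheaf.IsSheaf J (sectionsPresheaf M) :=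
  (Presheaf.isSheaf_iff_isSheaf_forget J M.val.presheaf (forget Ab)).1 M.isSheaf

lemma isSheaf_type_sectionsPresheaf (M : SheafOfModules.{u} A) :
    Presieve.IsSheaf J (sectionsPresheaf M) :=
  (isSheaf_iff_isSheaf_of_type _ _).1 (isSheaf_sectionsPresheaf M)

lemma section_ext (M : SheafOfModules.{u} A) {U : C} {T : Sieve U} (hT : T ∈ J U)
    {s t : M.val.obj (op U)}
    (h : ∀ ⦃V : C⦄ (g : V ⟶ U), T g → restrict M g s = restrict M g t) : s = t :=
  ((isSheaf_type_sectionsPresheaf M).isSeparated _ hT).ext h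

lemma exists_section_of_locally_unique (M : SheafOfModules.{u} A) {U : C}
    (P : ∀ ⦃V : C⦄, (V ⟶ U) → M.val.obj (op V) → Prop)
    (hP : ∀ ⦃V W : C⦄ (h : W ⟶ V) (g : V ⟶ U) (s : M.val.obj (op V)), P g s →
      P (h ≫ g) (restrict M h s))
    (hu : ∀ ⦃V : C⦄ (g : V ⟶ U) (s s' : M.val.obj (op V)), P g s → P g s' → s = s')
    {T : Sieve U} (hT : T ∈ J U) (he : ∀ ⦃V : C⦄ (g : V ⟶ U), T g → ∃ s, P g s) :
    ∃ s : M.val.obj (op U), ∀ ⦃V : C⦄ (g : V ⟶ U) (s' : M.val.obj (op V)), P g s' →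
      restrict M g s = s' :=
  (isSheaf_type_sectionsPresheaf M).exists_of_locally_unique P hP hu T hT he

lemma restrict_id (M : SheafOfModules.{u} A) {U : C} (s : M.val.obj (op U)) :
    restrict M (𝟙 U) s = s :=
  (sectionsPresheaf M).map_id_apply (op U) s

lemma hom_ext_sections {N M : SheafOfModules.{u} A} {f g : N ⟶ M}
    (h : ∀ (U : C) (s : N.val.obj (op U)), mapSection f s = mapSection g s) : f = g := by
  refine SheafOfModules.hom_ext (PresheafOfModules.hom_ext fun U ↦ ?_)
  ext s
  exact h U.unop s

/-- The map of sheaves of modules given by compatible linear maps on sections. -/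
noncomputable def homOfSections {N M : SheafOfModules.{u} A}
    (φ : ∀ U : C, N.val.obj (op U) → M.val.obj (op U))
    (h_add : ∀ (U : C) (s t : N.val.obj (op U)), φ U (s + t) = φ U s + φ U t)
    (h_smul : ∀ (U : C) (a : A.obj.obj (op U)) (s : N.val.obj (op U)), φ U (a • s) = a • φ U s)
    (h_res : ∀ ⦃U V : C⦄ (g : V ⟶ U) (s : N.val.obj (op U)),
      restrict M g (φ U s) = φ V (restrict N g s)) : N ⟶ M where
  val :=
    { app := fun U ↦ ModuleCat.ofHom
        { toFun := φ U.unop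
          map_add' := h_add U.unop
          map_smul' := h_smul U.unop }
      naturality := fun {U V} g ↦ by
        ext s
        exact (h_res g.unop s).symm }

lemma mapSection_homOfSections {N M : SheafOfModules.{u} A}
    (φ : ∀ U : C, N.val.obj (op U) → M.val.obj (op U)) (h_add h_smul h_res) {U : C}
    (s : N.val.obj (op U)) : mapSection (homOfSections φ h_add h_smul h_res) s = φ U s := rfl

/-- A square of sheaves of modules is cartesian if it is so on sections. -/
lemma isPullback_of_sections {P N N' M : SheafOfModules.{u} A} {p : P ⟶ N} {p' : P ⟶ N'}
    {f : N ⟶ M} {f' : N' ⟶ M} (w : p ≫ f = p' ≫ f')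
    (h : ∀ (U : C) (x : N.val.obj (op U)) (y : N'.val.obj (op U)),
      mapSection f x = mapSection f' y → ∃! z, mapSection p z = x ∧ mapSection p' z = y) :
    IsPullback p p' f f' := by
  choose! l hl hl' using h
  have hw (s : PullbackCone f f') {U : C} (x : s.pt.val.obj (op U)) :
      mapSection f (mapSection s.fst x) = mapSection f' (mapSection s.snd x) := by
    rw [← mapSection_comp, s.condition, mapSection_comp]
  let lift (s : PullbackCone f f') : s.pt ⟶ P :=
    homOfSections (fun U x ↦ l U (mapSection s.fst x) (mapSection s.snd x))
      (fun U x y ↦ by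
        refine (hl' U _ _ (hw s _) _ ⟨?_, ?_⟩).symm
        · rw [mapSection_add, (hl U _ _ (hw s x)).1, (hl U _ _ (hw s y)).1, mapSection_add]
        · rw [mapSection_add, (hl U _ _ (hw s x)).2, (hl U _ _ (hw s y)).2, mapSection_add])
      (fun U a x ↦ by
        refine (hl' U _ _ (hw s _) _ ⟨?_, ?_⟩).symm
        · rw [mapSection_smul, (hl U _ _ (hw s x)).1, mapSection_smul]
        · rw [mapSection_smul, (hl U _ _ (hw s x)).2, mapSection_smul])
      (fun U V g x ↦ by
        refine hl' V _ _ (hw s _) _ ⟨?_, ?_⟩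
        · rw [← restrict_mapSection, (hl U _ _ (hw s x)).1, restrict_mapSection]
        · rw [← restrict_mapSection, (hl U _ _ (hw s x)).2, restrict_mapSection])
  refine ⟨⟨w⟩, ⟨PullbackCone.IsLimit.mk w lift ?_ ?_ ?_⟩⟩
  · exact fun s ↦ hom_ext_sections fun U x ↦ (hl U _ _ (hw s x)).1
  · exact fun s ↦ hom_ext_sections fun U x ↦ (hl U _ _ (hw s x)).2
  · intro s m h₁ h₂
    refine hom_ext_sections fun U x ↦ hl' U _ _ (hw s x) _ ⟨?_, ?_⟩
    · rw [← h₁, mapSection_comp]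
    · rw [← h₂, mapSection_comp]

lemma pullback_section_ext {N P M : SheafOfModules.{u} A} (f : N ⟶ M) (h : P ⟶ M) {U : C}
    {z z' : (pullback f h).val.obj (op U)}
    (h₁ : mapSection (pullback.fst f h) z = mapSection (pullback.fst f h) z')
    (h₂ : mapSection (pullback.snd f h) z = mapSection (pullback.snd f h) z') : z = z' := by
  have hp := ((IsPullback.of_hasPullback f h).map (SheafOfModules.evaluation A (op U))).map
    (forget (ModuleCat (A.obj.obj (op U))))
  exact (Types.isPullback_iff _ _ _ _).1 hp |>.2.1 z z' ⟨h₁, h₂⟩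

/-- Maps of sheaves of modules glue along covering families. -/
lemma exists_hom_of_isCoveringFamily {ι : Type*} {N P : SheafOfModules.{u} A}
    {X : ι → SheafOfModules.{u} A} {f : ∀ i, X i ⟶ N} (hf : IsCoveringFamily f)
    (φ : ∀ i, X i ⟶ P)
    (hφ : ∀ ⦃Z : SheafOfModules.{u} A⦄ ⦃i j : ι⦄ (a : Z ⟶ X i) (b : Z ⟶ X j),
      a ≫ f i = b ≫ f j → a ≫ φ i = b ≫ φ j) :
    ∃! ψ : N ⟶ P, ∀ i, f i ≫ ψ = φ i := by
  classical
  -- The value of the glued map at a section of `N` does not depend on the lift: two lifts form a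
  -- section of the fibre product, where `hφ` applies.
  have hc {U : C} {i j : ι} (x : (X i).val.obj (op U)) (y : (X j).val.obj (op U))
      (h : mapSection (f i) x = mapSection (f j) y) :
      mapSection (φ i) x = mapSection (φ j) y := by
    obtain ⟨z, rfl, rfl⟩ := exists_pullback_section (f i) (f j) x y h
    rw [← mapSection_comp, ← mapSection_comp, hφ _ _ pullback.condition]
  have key (U : C) (n : N.val.obj (op U)) : ∃ s : P.val.obj (op U), ∀ ⦃V : C⦄ (g : V ⟶ U) (i : ι)
      (x : (X i).val.obj (op V)), mapSection (f i) x = restrict N g n →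
        restrict P g s = mapSection (φ i) x := by
    obtain ⟨T, hT, H⟩ := hf U {n}
    obtain ⟨s, hs⟩ := exists_section_of_locally_unique P
      (fun V (g : V ⟶ U) s ↦ ∃ (i : ι) (x : (X i).val.obj (op V)),
        mapSection (f i) x = restrict N g n ∧ s = mapSection (φ i) x)
      (fun V W h g s ⟨i, x, hx, hs⟩ ↦ ⟨i, restrict _ h x, by
        rw [← restrict_mapSection, hx, restrict_comp], by rw [hs, restrict_mapSection]⟩)
      (fun V g s s' ⟨i, x, hx, hs⟩ ⟨j, y, hy, hs'⟩ ↦ by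
        rw [hs, hs', hc x y (hx.trans hy.symm)]) hT
      (fun V g hg ↦ by
        obtain ⟨i, hi⟩ := H g hg
        obtain ⟨x, hx⟩ := hi n (by simp)
        exact ⟨_, i, x, hx, rfl⟩)
    exact ⟨s, fun V g i x hx ↦ hs g _ ⟨i, x, hx, rfl⟩⟩
  choose φ' hφ' using key
  refine ⟨homOfSections φ' ?_ ?_ ?_, ?_, ?_⟩
  · intro U m n
    -- Both sections must lift to the same member for additivity of `φ i` to be usable.
    obtain ⟨T, hT, H⟩ := hf U {m, n}
    refine section_ext P hT fun V g hg ↦ ?_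
    obtain ⟨i, hi⟩ := H g hg
    obtain ⟨x, hx⟩ := hi m (by simp)
    obtain ⟨y, hy⟩ := hi n (by simp)
    rw [restrict_add, hφ' U m g i x hx, hφ' U n g i y hy,
      hφ' U (m + n) g i (x + y) (by rw [mapSection_add, hx, hy, restrict_add]), mapSection_add]
  · intro U a n
    obtain ⟨T, hT, H⟩ := hf U {n}
    refine section_ext P hT fun V g hg ↦ ?_
    obtain ⟨i, hi⟩ := H g hg
    obtain ⟨x, hx⟩ := hi n (by simp)
    rw [restrict_smul, hφ' U n g i x hx, hφ' U (a • n) g i (A.obj.map g.op a • x)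
      (by rw [mapSection_smul, hx, restrict_smul]), mapSection_smul]
  · intro U V g n
    obtain ⟨T, hT, H⟩ := hf V {restrict N g n}
    refine section_ext P hT fun W h hh ↦ ?_
    obtain ⟨i, hi⟩ := H h hh
    obtain ⟨x, hx⟩ := hi _ (Finset.mem_singleton_self _)
    rw [hφ' V _ h i x hx, ← restrict_comp, hφ' U n (h ≫ g) i x (by rw [hx, restrict_comp])]
  · refine fun i ↦ hom_ext_sections fun U x ↦ ?_
    have := hφ' U (mapSection (f i) x) (𝟙 U) i x (restrict_id N _).symm
    rwa [restrict_id] at this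
  · intro ψ hψ
    refine hom_ext_sections fun U n ↦ ?_
    obtain ⟨T, hT, H⟩ := hf U {n}
    refine section_ext P hT fun V g hg ↦ ?_
    obtain ⟨i, hi⟩ := H g hg
    obtain ⟨x, hx⟩ := hi n (by simp)
    rw [mapSection_homOfSections, hφ' U n g i x hx, restrict_mapSection, ← hx, ← mapSection_comp,
      hψ]

instance : (modTopology A).Subcanonical :=
  .of_isSheaf_yoneda_obj _ fun P N R hR ↦ by
    rw [← Presieve.ofArrows_category R.arrows, Presieve.isSheafFor_arrows_iff]
    exact fun φ hφ ↦ exists_hom_of_isCoveringFamily hR φ fun Z i j a b h ↦ hφ i j Z a b h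

end ModuleSite

/-! ### Transport of sections in a descent datum of modules. -/

namespace ModuleSite

open Limits

variable {C : Type u} [SmallCategory C] {J : GrothendieckTopology C} {A : Sheaf J RingCat.{u}}

lemma mapSection_sum_smul {N M : SheafOfModules.{u} A} (f : N ⟶ M) {U : C} {n : ℕ}
    (a : Fin n → A.obj.obj (op U)) (s : Fin n → N.val.obj (op U)) :
    mapSection f (∑ k, a k • s k) = ∑ k, a k • mapSection f (s k) :=
  (map_sum (f.val.app (op U)).hom _ _).trans
    (Finset.sum_congr rfl fun k _ ↦ map_smul (f.val.app (op U)).hom (a k) (s k))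

lemma restrict_sum_smul (M : SheafOfModules.{u} A) {U V : C} (g : V ⟶ U) {n : ℕ}
    (a : Fin n → A.obj.obj (op U)) (s : Fin n → M.val.obj (op U)) :
    restrict M g (∑ k, a k • s k) = ∑ k, A.obj.map g.op (a k) • restrict M g (s k) :=
  (map_sum (M.val.map g.op).hom _ _).trans
    (Finset.sum_congr rfl fun k _ ↦ M.val.map_smul g.op (a k) (s k))

section Transport

variable {ι : Type t} {M : SheafOfModules.{u} A} {X : ι → SheafOfModules.{u} A}
  {f : ∀ i, X i ⟶ M} (D : (overPseudofunctor (SheafOfModules.{u} A)).DescentData f)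

open OverDescent

/-- The transport of a section of the `i`-th member of a descent datum to the `j`-th member, over a
given section of the base `X j`. -/
noncomputable def transport {U : C} {i j : ι} (δ : (obj D i).left.val.obj (op U))
    (y : (X j).val.obj (op U)) (h : mapSection ((obj D i).hom ≫ f i) δ = mapSection (f j) y) :
    (obj D j).left.val.obj (op U) :=
  mapSection (tr D (pullback.fst ((obj D i).hom ≫ f i) (f j)) (pullback.snd _ _)
    pullback.condition) (exists_pullback_section _ _ δ y h).choose

/-- By naturality of `tr`, transport may be computed on any `W` with a section inducing both given
sections, not only on the fibre product of the definition. -/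
lemma transport_mapSection {U : C} {W : SheafOfModules.{u} A} {i j : ι}
    (a : W ⟶ (obj D i).left) (b : W ⟶ X j) (h : a ≫ (obj D i).hom ≫ f i = b ≫ f j)
    (z : W.val.obj (op U)) (h') :
    transport D (mapSection a z) (mapSection b z) h' = mapSection (tr D a b h) z := by
  have hz := (exists_pullback_section ((obj D i).hom ≫ f i) (f j) _ _ h').choose_spec
  have : mapSection (pullback.lift a b h) z =
      (exists_pullback_section ((obj D i).hom ≫ f i) (f j) _ _ h').choose := by
    refine pullback_section_ext _ _ ?_ ?_
    · rw [hz.1, ← mapSection_comp, pullback.lift_fst]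
    · rw [hz.2, ← mapSection_comp, pullback.lift_snd]
  rw [transport, ← this, ← mapSection_comp, ← comp_tr]
  simp only [pullback.lift_fst, pullback.lift_snd]

lemma transport_eq {U : C} {W : SheafOfModules.{u} A} {i j : ι}
    (a : W ⟶ (obj D i).left) (b : W ⟶ X j) (h : a ≫ (obj D i).hom ≫ f i = b ≫ f j)
    (z : W.val.obj (op U)) {δ : (obj D i).left.val.obj (op U)} {y : (X j).val.obj (op U)}
    (hδ : mapSection a z = δ) (hy : mapSection b z = y) {h'} :
    transport D δ y h' = mapSection (tr D a b h) z := by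
  subst hδ hy
  exact transport_mapSection D a b h z h'

lemma transport_congr {U : C} {i j : ι} {δ δ' : (obj D i).left.val.obj (op U)}
    {y y' : (X j).val.obj (op U)} (hδ : δ = δ') (hy : y = y') {h h'} :
    transport D δ y h = transport D δ' y' h' := by
  subst hδ hy
  rfl

variable {U : C} {i j k : ι}

lemma mapSection_hom_transport (δ : (obj D i).left.val.obj (op U)) (y : (X j).val.obj (op U)) (h) :
    mapSection (obj D j).hom (transport D δ y h) = y := by
  obtain ⟨z, rfl, rfl⟩ := exists_pullback_section _ _ δ y h
  rw [transport_mapSection D _ _ pullback.condition, ← mapSection_comp, tr_hom]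

lemma transport_self (δ : (obj D i).left.val.obj (op U)) (h) :
    transport D δ (mapSection (obj D i).hom δ) h = δ := by
  have := transport_mapSection D (𝟙 (obj D i).left) (𝟙 _ ≫ (obj D i).hom)
    (Category.assoc _ _ _).symm δ h
  rw [tr_self] at this
  exact this

lemma transport_transport (δ : (obj D i).left.val.obj (op U)) (y : (X j).val.obj (op U))
    (x : (X k).val.obj (op U)) (h) (h') :
    transport D (transport D δ y h) x h' = transport D δ x (by
      rw [h, ← h', mapSection_comp, mapSection_hom_transport]) := by
  have hx : mapSection (f j) y = mapSection (f k) x := by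
    rw [← h', mapSection_comp, mapSection_hom_transport]
  -- The aim is one section of an iterated fibre product carrying `δ`, `y` and `x` at once, at which
  -- `tr_tr` can be evaluated.
  obtain ⟨z, hz, hz'⟩ := exists_pullback_section _ _ δ y h
  obtain ⟨z, rfl, rfl⟩ := exists_pullback_section (pullback.snd _ _ ≫ f j) (f k) z x
    (by rw [mapSection_comp, hz', hx])
  have e := pullback.condition (f := (obj D i).hom ≫ f i) (g := f j)
  have e₁ := (Category.assoc (pullback.fst (pullback.snd ((obj D i).hom ≫ f i) (f j) ≫ f j) (f k))
    _ _).trans (congrArg (pullback.fst (pullback.snd ((obj D i).hom ≫ f i) (f j) ≫ f j) (f k) ≫ ·) e)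
  rw [← Category.assoc (pullback.fst _ _) (pullback.snd _ _)] at e₁
  have e₂ := (Category.assoc _ _ _).trans
    (pullback.condition (f := pullback.snd ((obj D i).hom ≫ f i) (f j) ≫ f j) (g := f k))
  rw [transport_eq D _ _ (e₁.trans e₂) z hz rfl, ← tr_tr D _ _ _ e₁ e₂]
  exact transport_eq D _ _ _ z (transport_eq D _ _ e₁ z hz hz').symm rfl

lemma restrict_transport {V : C} (g : V ⟶ U) (δ : (obj D i).left.val.obj (op U))
    (y : (X j).val.obj (op U)) (h) :
    restrict _ g (transport D δ y h) = transport D (restrict _ g δ) (restrict _ g y) (by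
      rw [← restrict_mapSection, h, restrict_mapSection]) := by
  obtain ⟨z, rfl, rfl⟩ := exists_pullback_section _ _ δ y h
  rw [transport_mapSection D _ _ pullback.condition, restrict_mapSection]
  exact (transport_eq D _ _ _ _ (restrict_mapSection _ _ _).symm
    (restrict_mapSection _ _ _).symm).symm

/-- Transport is a morphism of modules on the fibre product, whose sections are pairs; hence it is
linear in the pair `(δ, y)`. -/
lemma transport_sum_smul {n : ℕ} (a : Fin n → A.obj.obj (op U))
    (δ : Fin n → (obj D i).left.val.obj (op U)) (y : Fin n → (X j).val.obj (op U))
    (h : ∀ l, mapSection ((obj D i).hom ≫ f i) (δ l) = mapSection (f j) (y l)) :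
    transport D (∑ l, a l • δ l) (∑ l, a l • y l) (by
      simp only [mapSection_sum_smul, h]) = ∑ l, a l • transport D (δ l) (y l) (h l) := by
  choose z hz hz' using fun l ↦ exists_pullback_section _ _ (δ l) (y l) (h l)
  obtain rfl := funext hz
  obtain rfl := funext hz'
  simp only [transport_mapSection D _ _ pullback.condition, ← mapSection_sum_smul]

/-- Sections of two members of a descent datum are related if one is the transport of the other. -/
def Related (δ : (obj D i).left.val.obj (op U)) (ε : (obj D j).left.val.obj (op U)) : Prop :=
  ∃ h, transport D δ (mapSection (obj D j).hom ε) h = ε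

variable {D}

namespace Related

lemma refl (δ : (obj D i).left.val.obj (op U)) : Related D δ δ :=
  ⟨mapSection_comp _ _ _, transport_self D δ _⟩

lemma mapSection_eq {δ : (obj D i).left.val.obj (op U)} {ε : (obj D j).left.val.obj (op U)}
    (h : Related D δ ε) :
    mapSection ((obj D i).hom ≫ f i) δ = mapSection ((obj D j).hom ≫ f j) ε := by
  rw [h.choose, ← mapSection_comp]

lemma symm {δ : (obj D i).left.val.obj (op U)} {ε : (obj D j).left.val.obj (op U)}
    (h : Related D δ ε) : Related D ε δ := by
  have e := h.mapSection_eq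
  obtain ⟨h, hε⟩ := h
  refine ⟨by rw [← e, mapSection_comp], ?_⟩
  exact (transport_congr D hε.symm rfl).trans ((transport_transport D δ _ _ h
    (by rw [hε, ← e, mapSection_comp])).trans (transport_self D δ _))

lemma trans {δ : (obj D i).left.val.obj (op U)} {ε : (obj D j).left.val.obj (op U)}
    {ζ : (obj D k).left.val.obj (op U)} (h : Related D δ ε) (h' : Related D ε ζ) :
    Related D δ ζ := by
  have e := h.mapSection_eq
  have e' := h'.mapSection_eq
  obtain ⟨h, hε⟩ := h
  obtain ⟨h', hζ⟩ := h'
  refine ⟨by rw [e, e', mapSection_comp], ?_⟩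
  rw [← transport_transport D δ _ (mapSection (obj D k).hom ζ) h (by rw [hε, h'])]
  refine Eq.trans ?_ hζ
  congr 1

lemma restrict {V : C} (g : V ⟶ U) {δ : (obj D i).left.val.obj (op U)}
    {ε : (obj D j).left.val.obj (op U)} (h : Related D δ ε) :
    Related D (restrict _ g δ) (restrict _ g ε) := by
  obtain ⟨h, hε⟩ := h
  refine ⟨by rw [← restrict_mapSection, h, restrict_mapSection, restrict_mapSection], ?_⟩
  refine Eq.trans ?_ ((restrict_transport D g _ _ h).symm.trans (congrArg _ hε))
  congr 1
  rw [restrict_mapSection]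

/-- Relatedness consists of two equalities of sections of sheaves, and each can be checked locally.
-/
lemma of_locally {T : Sieve U} (hT : T ∈ J U) {δ : (obj D i).left.val.obj (op U)}
    {ε : (obj D j).left.val.obj (op U)}
    (h : ∀ ⦃V : C⦄ (g : V ⟶ U), T g →
      Related D (ModuleSite.restrict _ g δ) (ModuleSite.restrict _ g ε)) : Related D δ ε := by
  have e : mapSection ((obj D i).hom ≫ f i) δ = mapSection (f j) (mapSection (obj D j).hom ε) :=
    section_ext _ hT fun V g hg ↦ by
      rw [restrict_mapSection, (h g hg).choose, restrict_mapSection, restrict_mapSection]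
  refine ⟨e, section_ext _ hT fun V g hg ↦ ?_⟩
  rw [restrict_transport]
  obtain ⟨h', hε⟩ := h g hg
  refine Eq.trans ?_ hε
  congr 1
  rw [restrict_mapSection]

lemma sum_smul {n : ℕ} (a : Fin n → A.obj.obj (op U)) {δ : Fin n → (obj D i).left.val.obj (op U)}
    {ε : Fin n → (obj D j).left.val.obj (op U)} (h : ∀ l, Related D (δ l) (ε l)) :
    Related D (∑ l, a l • δ l) (∑ l, a l • ε l) := by
  choose h hε using h
  refine ⟨by simp only [mapSection_sum_smul, h], ?_⟩
  refine Eq.trans ?_ ((transport_sum_smul D a _ _ h).trans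
    (Finset.sum_congr rfl fun l _ ↦ congrArg _ (hε l)))
  congr 1
  exact mapSection_sum_smul _ _ _

/-- A section over `y` related to a given one exists and is unique. -/
lemma existsUnique (δ : (obj D i).left.val.obj (op U)) (y : (X j).val.obj (op U))
    (h : mapSection ((obj D i).hom ≫ f i) δ = mapSection (f j) y) :
    ∃! ε, Related D δ ε ∧ mapSection (obj D j).hom ε = y := by
  refine ⟨transport D δ y h, ⟨⟨?_, ?_⟩, mapSection_hom_transport D δ y h⟩, ?_⟩
  · rw [mapSection_hom_transport, h]
  · congr 1
    exact mapSection_hom_transport D δ y h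
  · rintro ε ⟨⟨h', hε⟩, rfl⟩
    exact hε.symm

end Related

lemma related_tr {W : SheafOfModules.{u} A} (a : W ⟶ (obj D i).left) (b : W ⟶ X j)
    (h : a ≫ (obj D i).hom ≫ f i = b ≫ f j) (z : W.val.obj (op U)) :
    Related D (mapSection a z) (mapSection (tr D a b h) z) := by
  have e : mapSection b z = mapSection (obj D j).hom (mapSection (tr D a b h) z) := by
    rw [← mapSection_comp, tr_hom]
  exact ⟨by rw [← e, ← mapSection_comp, h, mapSection_comp], transport_eq D a b h z rfl e⟩

end Transport

end ModuleSite

/-! ### Quotient of a family of sheaves of sets by a local equivalence relation. -/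

namespace CategoryTheory.Presheaf

variable {C : Type u} [SmallCategory C] {J : GrothendieckTopology C}

/-- The quotient of a family of presheaves of sets by a local equivalence relation on their sections
is represented by a sheaf of sets if it is small. -/
lemma exists_isSheaf_glue {ι : Type t} (D : ι → Cᵒᵖ ⥤ Type u) {M : Cᵒᵖ ⥤ Type u}
    (hM : Presheaf.IsSheaf J M) (φ : ∀ i, D i ⟶ M)
    (r : ∀ U : C, Setoid (Σ i, (D i).obj (op U)))
    [∀ U, Small.{u} (_root_.Quotient (r U))]
    (r_map : ∀ ⦃U V : C⦄ (g : V ⟶ U) (i j) (x : (D i).obj (op U)) (y : (D j).obj (op U)),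
      r U ⟨i, x⟩ ⟨j, y⟩ → r V ⟨i, (D i).map g.op x⟩ ⟨j, (D j).map g.op y⟩)
    (r_local : ∀ (U : C) (T : Sieve U), T ∈ J U → ∀ (i j) (x : (D i).obj (op U))
      (y : (D j).obj (op U)), (∀ ⦃V : C⦄ (g : V ⟶ U), T g →
        r V ⟨i, (D i).map g.op x⟩ ⟨j, (D j).map g.op y⟩) → r U ⟨i, x⟩ ⟨j, y⟩)
    (r_φ : ∀ (U : C) (i j) (x : (D i).obj (op U)) (y : (D j).obj (op U)),
      r U ⟨i, x⟩ ⟨j, y⟩ → (φ i).app _ x = (φ j).app _ y) :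
    ∃ (F : Cᵒᵖ ⥤ Type u) (_ : Presheaf.IsSheaf J F) (κ : ∀ i, D i ⟶ F) (p : F ⟶ M),
      (∀ i, κ i ≫ p = φ i) ∧
      (∀ (U : C) (i j) (x : (D i).obj (op U)) (y : (D j).obj (op U)),
        (κ i).app _ x = (κ j).app _ y ↔ r U ⟨i, x⟩ ⟨j, y⟩) ∧
      ∀ (U : C) (s : F.obj (op U)), ∃ T ∈ J U, ∀ ⦃V : C⦄ (g : V ⟶ U), T g →
        ∃ i x, (κ i).app (op V) x = F.map g.op s := by
  let res {U V : C} (g : V ⟶ U) : _root_.Quotient (r U) → _root_.Quotient (r V) :=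
    _root_.Quotient.map (fun x ↦ ⟨x.1, (D x.1).map g.op x.2⟩)
      (fun x y h ↦ r_map g x.1 y.1 x.2 y.2 h)
  let E : Cᵒᵖ ⥤ Type u :=
    { obj := fun U ↦ Shrink.{u} (_root_.Quotient (r U.unop))
      map := fun g ↦ ↾fun x ↦ equivShrink _ (res g.unop ((equivShrink _).symm x))
      map_id := fun U ↦ by
        ext x
        obtain ⟨x, rfl⟩ := (equivShrink _).surjective x
        obtain ⟨⟨i, x⟩, rfl⟩ := _root_.Quotient.exists_rep x
        simp [res]
      map_comp := fun g h ↦ by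
        ext x
        obtain ⟨x, rfl⟩ := (equivShrink _).surjective x
        obtain ⟨⟨i, x⟩, rfl⟩ := _root_.Quotient.exists_rep x
        simp [res] }
  let κ₀ (i : ι) : D i ⟶ E :=
    { app := fun U ↦ ↾fun x ↦ equivShrink _ (_root_.Quotient.mk _ ⟨i, x⟩)
      naturality := fun U V g ↦ by
        ext x
        simp [E, res] }
  have κ₀_eq {U : C} {i j : ι} (x : (D i).obj (op U)) (y : (D j).obj (op U)) :
      (κ₀ i).app _ x = (κ₀ j).app _ y ↔ r U ⟨i, x⟩ ⟨j, y⟩ :=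
    (equivShrink _).injective.eq_iff.trans _root_.Quotient.eq
  have κ₀_surj {U : C} (s : E.obj (op U)) : ∃ i x, (κ₀ i).app _ x = s := by
    obtain ⟨s, rfl⟩ := (equivShrink _).surjective s
    obtain ⟨⟨i, x⟩, rfl⟩ := _root_.Quotient.exists_rep s
    exact ⟨i, x, rfl⟩
  let p₀ : E ⟶ M :=
    { app := fun U ↦ ↾fun x ↦ _root_.Quotient.lift (fun x ↦ (φ x.1).app U x.2)
        (fun x y h ↦ r_φ U.unop x.1 y.1 x.2 y.2 h) ((equivShrink _).symm x)
      naturality := fun U V g ↦ by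
        ext s
        obtain ⟨i, x, rfl⟩ := κ₀_surj s
        simp [E, κ₀, res] }
  refine ⟨J.sheafify E, J.sheafify_isSheaf E, fun i ↦ κ₀ i ≫ J.toSheafify E,
    J.sheafifyLift p₀ hM, fun i ↦ ?_, fun U i j x y ↦ ⟨fun h ↦ ?_, fun h ↦ ?_⟩, fun U s ↦ ?_⟩
  · rw [Category.assoc, GrothendieckTopology.toSheafify_sheafifyLift]
    ext U x
    simp [κ₀, p₀]
  · refine r_local U _ (equalizerSieve_mem J (J.toSheafify E) _ _ h) _ _ _ _ fun V g hg ↦ ?_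
    rw [← κ₀_eq, NatTrans.naturality_apply, NatTrans.naturality_apply]
    exact hg
  · exact congrArg ((J.toSheafify E).app _) ((κ₀_eq x y).2 h)
  · refine ⟨_, imageSieve_mem J (J.toSheafify E) s, ?_⟩
    rintro V g ⟨e, he⟩
    obtain ⟨i, x, rfl⟩ := κ₀_surj e
    exact ⟨i, x, he⟩

end CategoryTheory.Presheaf

/-! ### Gluing the linear structures. -/

namespace ModuleSite

variable {C : Type u} [SmallCategory C] {J : GrothendieckTopology C} {A : Sheaf J RingCat.{u}}

/-- A sheaf of sets covered by sheaves of modules with compatible linear structures is a sheaf of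
modules. -/
lemma exists_sheafOfModules_glue {ι : Type t} (N : ι → SheafOfModules.{u} A) {F : Cᵒᵖ ⥤ Type u}
    (hF : Presheaf.IsSheaf J F) (κ : ∀ (i) {U : C}, (N i).val.obj (op U) → F.obj (op U))
    (κ_map : ∀ {U V : C} (g : V ⟶ U) (i) (x : (N i).val.obj (op U)),
      F.map g.op (κ i x) = κ i (restrict (N i) g x))
    (hlift : ∀ (U : C) (Λ : Finset (F.obj (op U))), ∃ T ∈ J U, ∀ ⦃V : C⦄ (g : V ⟶ U), T g →
      ∃ i, ∀ s ∈ Λ, ∃ x, κ i x = F.map g.op s)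
    (hκ : ∀ (U : C) (i j : ι) (n : ℕ) (a : Fin n → A.obj.obj (op U))
      (x : Fin n → (N i).val.obj (op U)) (y : Fin n → (N j).val.obj (op U)),
      (∀ k, κ i (x k) = κ j (y k)) →
        κ i (∑ k, a k • x k) =
          κ j (∑ k, a k • y k)) :
    ∃ (E : SheafOfModules.{u} A) (θ : F ≅ sectionsPresheaf E) (κ' : ∀ i, N i ⟶ E),
      ∀ (U : C) (i : ι) (x : (N i).val.obj (op U)),
        mapSection (κ' i) x = θ.hom.app (op U) (κ i x) := by
  classical
  have hF' := (isSheaf_iff_isSheaf_of_type _ _).1 hF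
  -- A linear combination in `F` is glued from combinations of simultaneous lifts to one `N i`; `hκ`
  -- makes it independent of the lifts.
  have key (U : C) (n : ℕ) (a : Fin n → A.obj.obj (op U)) (e : Fin n → F.obj (op U)) :
      ∃ s : F.obj (op U), ∀ ⦃V : C⦄ (g : V ⟶ U) (i : ι) (x : Fin n → (N i).val.obj (op V)),
        (∀ k, κ i (x k) = F.map g.op (e k)) →
          F.map g.op s = κ i
            (∑ k, A.obj.map g.op (a k) • x k) := by
    obtain ⟨T, hT, H⟩ := hlift U (Finset.univ.image e)
    obtain ⟨s, hs⟩ := hF'.exists_of_locally_unique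
      (fun V (g : V ⟶ U) s ↦ ∃ (i : ι) (x : Fin n → (N i).val.obj (op V)),
        (∀ k, κ i (x k) = F.map g.op (e k)) ∧ s = κ i
            (∑ k, A.obj.map g.op (a k) • x k))
      (fun V W h g s ⟨i, x, hx, hs⟩ ↦ ⟨i, fun k ↦ restrict _ h (x k), fun k ↦ by
        rw [← κ_map, hx, op_comp, Functor.map_comp_apply], by
        rw [hs, κ_map, restrict_sum_smul]
        simp only [op_comp, Functor.map_comp]
        rfl⟩)
      (fun V g s s' ⟨i, x, hx, hs⟩ ⟨j, y, hy, hs'⟩ ↦ by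
        rw [hs, hs']
        exact hκ V i j n _ _ _ fun k ↦ (hx k).trans (hy k).symm) T hT
      (fun V g hg ↦ by
        obtain ⟨i, hi⟩ := H g hg
        choose x hx using fun k ↦ hi (e k) (Finset.mem_image_of_mem _ (Finset.mem_univ k))
        exact ⟨_, i, x, hx, rfl⟩)
    exact ⟨s, fun V g i x hx ↦ hs g _ ⟨i, x, hx, rfl⟩⟩
  choose comb hcomb using key
  -- Sum, zero and scalar multiple are the combinations of length 2, 0 and 1.
  let add {U : C} (s t : F.obj (op U)) : F.obj (op U) := comb U 2 ![1, 1] ![s, t]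
  let zero {U : C} : F.obj (op U) := comb U 0 ![] ![]
  let smul {U : C} (a : A.obj.obj (op U)) (s : F.obj (op U)) : F.obj (op U) := comb U 1 ![a] ![s]
  have add_spec {U V : C} (g : V ⟶ U) (i : ι) {x y : (N i).val.obj (op V)} {s t : F.obj (op U)}
      (hs : κ i x = F.map g.op s) (ht : κ i y = F.map g.op t) :
      κ i (x + y : (N i).val.obj (op V)) = F.map g.op (add s t) := by
    rw [hcomb U 2 ![1, 1] ![s, t] g i ![x, y] (by simp [Fin.forall_fin_two, hs, ht])]
    simp [Fin.sum_univ_two]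
  have zero_spec {U V : C} (g : V ⟶ U) (i : ι) :
      κ i (0 : (N i).val.obj (op V)) = F.map g.op zero := by
    rw [hcomb U 0 ![] ![] g i ![] (by simp)]
    simp
  have smul_spec {U V : C} (g : V ⟶ U) (i : ι) (a : A.obj.obj (op U)) {x : (N i).val.obj (op V)}
      {s : F.obj (op U)} (hs : κ i x = F.map g.op s) :
      κ i (A.obj.map g.op a • x : (N i).val.obj (op V)) = F.map g.op (smul a s) := by
    rw [hcomb U 1 ![a] ![s] g i ![x] (by simp [hs])]
    simp
  -- An identity involving the sections in `Λ` may be checked where all of them lift to one `N i`;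
  -- there it becomes a module axiom.
  have ext_lift {U : C} (Λ : Finset (F.obj (op U))) (s t : F.obj (op U))
      (h : ∀ ⦃V : C⦄ (g : V ⟶ U) (i : ι), (∀ e ∈ Λ, ∃ x, κ i x = F.map g.op e) →
        F.map g.op s = F.map g.op t) : s = t := by
    obtain ⟨T, hT, H⟩ := hlift U Λ
    refine (hF'.isSeparated T hT).ext fun V g hg ↦ ?_
    obtain ⟨i, hi⟩ := H g hg
    exact h g i hi
  let inst₀ (U : C) : Add (F.obj (op U)) := ⟨add⟩
  let inst₀' (U : C) : Zero (F.obj (op U)) := ⟨zero⟩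
  let inst₀'' (U : C) : Neg (F.obj (op U)) := ⟨smul (-1)⟩
  let inst₁ (U : C) : AddCommGroup (F.obj (op U)) :=
    { nsmul := nsmulRec
      zsmul := zsmulRec
      add_assoc := fun r s t ↦ ext_lift {r, s, t} _ _ fun V g i h ↦ by
        obtain ⟨x, hx⟩ := h r (by simp)
        obtain ⟨y, hy⟩ := h s (by simp)
        obtain ⟨z, hz⟩ := h t (by simp)
        refine (add_spec g i (add_spec g i hx hy) hz).symm.trans ?_
        rw [add_assoc]
        exact add_spec g i hx (add_spec g i hy hz)
      zero_add := fun s ↦ ext_lift {s} _ _ fun V g i h ↦ by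
        obtain ⟨x, hx⟩ := h s (by simp)
        refine (add_spec g i (zero_spec g i) hx).symm.trans ?_
        rw [zero_add, hx]
      add_zero := fun s ↦ ext_lift {s} _ _ fun V g i h ↦ by
        obtain ⟨x, hx⟩ := h s (by simp)
        refine (add_spec g i hx (zero_spec g i)).symm.trans ?_
        rw [add_zero, hx]
      neg_add_cancel := fun s ↦ ext_lift {s} _ _ fun V g i h ↦ by
        obtain ⟨x, hx⟩ := h s (by simp)
        refine (add_spec g i (smul_spec g i (-1) hx) hx).symm.trans ?_
        rw [map_neg, map_one, neg_one_smul, neg_add_cancel]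
        exact zero_spec g i
      add_comm := fun s t ↦ ext_lift {s, t} _ _ fun V g i h ↦ by
        obtain ⟨x, hx⟩ := h s (by simp)
        obtain ⟨y, hy⟩ := h t (by simp)
        refine (add_spec g i hx hy).symm.trans ?_
        rw [add_comm]
        exact add_spec g i hy hx }
  let P : Cᵒᵖ ⥤ Ab.{u} :=
    { obj := fun U ↦ letI := inst₁ U.unop; .of (F.obj U)
      map := fun {U V} g ↦ letI := inst₁ U.unop; letI := inst₁ V.unop
        AddCommGrpCat.ofHom (AddMonoidHom.mk' (F.map g) fun s t ↦
          ext_lift {F.map g s, F.map g t} _ _ fun W h i H ↦ by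
            obtain ⟨x, hx⟩ := H (F.map g s) (by simp)
            obtain ⟨y, hy⟩ := H (F.map g t) (by simp)
            refine Eq.trans ?_ (add_spec h i hx hy)
            rw [← Functor.map_comp_apply] at hx hy ⊢
            exact (add_spec (h ≫ g.unop) i hx hy).symm)
      map_id := fun U ↦ by
        ext s
        exact F.map_id_apply U s
      map_comp := fun g h ↦ by
        ext s
        exact F.map_comp_apply g h s }
  let inst₂ (U : Cᵒᵖ) : Module (A.obj.obj U) (P.obj U) :=
    { smul := smul
      one_smul := fun s ↦ ext_lift {s} _ _ fun V g i h ↦ by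
        obtain ⟨x, hx⟩ := h s (by simp)
        refine (smul_spec g i 1 hx).symm.trans ?_
        rw [map_one, one_smul, hx]
      mul_smul := fun a b s ↦ ext_lift {s} _ _ fun V g i h ↦ by
        obtain ⟨x, hx⟩ := h s (by simp)
        refine (smul_spec g i (a * b) hx).symm.trans ?_
        rw [map_mul, mul_smul]
        exact smul_spec g i a (smul_spec g i b hx)
      smul_zero := fun a ↦ ext_lift ∅ _ _ fun V g i h ↦ by
        refine (smul_spec g i a (zero_spec g i)).symm.trans ?_
        rw [smul_zero]
        exact zero_spec g i
      smul_add := fun a s t ↦ ext_lift {s, t} _ _ fun V g i h ↦ by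
        obtain ⟨x, hx⟩ := h s (by simp)
        obtain ⟨y, hy⟩ := h t (by simp)
        refine (smul_spec g i a (add_spec g i hx hy)).symm.trans ?_
        rw [smul_add]
        exact add_spec g i (smul_spec g i a hx) (smul_spec g i a hy)
      add_smul := fun a b s ↦ ext_lift {s} _ _ fun V g i h ↦ by
        obtain ⟨x, hx⟩ := h s (by simp)
        refine (smul_spec g i (a + b) hx).symm.trans ?_
        rw [map_add, add_smul]
        exact add_spec g i (smul_spec g i a hx) (smul_spec g i b hx)
      zero_smul := fun s ↦ ext_lift {s} _ _ fun V g i h ↦ by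
        obtain ⟨x, hx⟩ := h s (by simp)
        refine (smul_spec g i 0 hx).symm.trans ?_
        rw [map_zero, zero_smul]
        exact zero_spec g i }
  let θ : F ≅ P ⋙ forget Ab := NatIso.ofComponents fun U ↦ Iso.refl _
  let E : SheafOfModules.{u} A :=
    { val := PresheafOfModules.ofPresheaf P fun U V g a s ↦
        ext_lift {F.map g s} _ _ fun W h i H ↦ by
          obtain ⟨x, hx⟩ := H (F.map g s) (by simp)
          refine Eq.trans ?_ (smul_spec h i (A.obj.map g a) hx)
          rw [← Functor.map_comp_apply] at hx
          refine (Functor.map_comp_apply _ _ _ _).symm.trans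
            ((smul_spec (h ≫ g.unop) i a hx).symm.trans ?_)
          rw [op_comp, Functor.map_comp_apply]
          rfl
      isSheaf := (Presheaf.isSheaf_iff_isSheaf_forget J P (forget Ab)).2
        ((Presheaf.isSheaf_of_iso_iff θ).1 hF) }
  have map_id (U : C) (s : F.obj (op U)) : F.map (𝟙 U).op s = s := F.map_id_apply _ s
  refine ⟨E, θ, fun i ↦ homOfSections (fun U x ↦ κ i x) ?_ ?_ ?_, fun U i x ↦ rfl⟩
  · exact fun U x y ↦ (add_spec (𝟙 U) i (map_id U _).symm (map_id U _).symm).trans (map_id U _)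
  · intro U a x
    have := (smul_spec (𝟙 U) i a (map_id U (κ i x)).symm).trans (map_id U _)
    rwa [show A.obj.map (𝟙 U).op a = a from A.obj.map_id_apply (op U) a] at this
  · exact fun U V g x ↦ κ_map g i x

end ModuleSite

/-! ### Effectiveness of descent. -/

namespace ModuleSite

open Limits OverDescent

variable {C : Type u} [SmallCategory C] {J : GrothendieckTopology C} {A : Sheaf J RingCat.{u}}

/-- The map of underlying presheaves of sets of a map of sheaves of modules. -/
noncomputable def sectionsMap {N M : SheafOfModules.{u} A} (f : N ⟶ M) :
    sectionsPresheaf N ⟶ sectionsPresheaf M where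
  app U := ↾fun s ↦ mapSection (U := U.unop) f s
  naturality U V g := by
    ext s
    exact (restrict_mapSection f g.unop s).symm

section

variable {ι : Type t} {M : SheafOfModules.{u} A} {X : ι → SheafOfModules.{u} A}
  {f : ∀ i, X i ⟶ M} (D : (overPseudofunctor (SheafOfModules.{u} A)).DescentData f)

/-- The equivalence relation on the sections over `U` of the members of a descent datum. -/
def relatedSetoid (U : C) : Setoid (Σ i, (sectionsPresheaf (obj D i).left).obj (op U)) where
  r x y := Related D (U := U) x.2 y.2
  iseqv := ⟨fun _ ↦ .refl _, .symm, .trans⟩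

/-- The index type may be large, as for a sieve on `A-mod`. For each section of `M` over `U` that
lifts, one lift `y` is fixed; every class over that section is transported to a section over `y`, so
a small set of sections meets all classes. -/
instance (U : C) : Small.{u} (_root_.Quotient (relatedSetoid D U)) := by
  let L := {m : M.val.obj (op U) // ∃ (i : ι) (y : (X i).val.obj (op U)), mapSection (f i) y = m}
  choose i y hy using fun m : L ↦ m.2
  refine small_of_surjective (α := Σ m : L, (obj D (i m)).left.val.obj (op U))
    (f := fun x ↦ Quotient.mk _ ⟨i x.1, x.2⟩) fun q ↦ ?_
  obtain ⟨⟨j, ε⟩, rfl⟩ := _root_.Quotient.exists_rep q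
  let m : L := ⟨mapSection ((obj D j).hom ≫ f j) (U := U) ε, j, mapSection (obj D j).hom (U := U) ε,
    (mapSection_comp _ _ _).symm⟩
  obtain ⟨δ, ⟨hδ, -⟩, -⟩ := Related.existsUnique (D := D) ε (y m) (hy m).symm
  exact ⟨⟨m, δ⟩, Quotient.sound hδ.symm⟩

/-- Descent data of sheaves of modules over a sheaf of modules `M` are effective for covering
families. -/
lemma exists_glued_over (hf : IsCoveringFamily f) :
    ∃ (E : Over M) (κ : ∀ i, (obj D i).left ⟶ E.left),
      (∀ i, IsPullback (κ i) (obj D i).hom E.hom (f i)) ∧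
      ∀ ⦃W : SheafOfModules.{u} A⦄ ⦃i j : ι⦄ (a : W ⟶ (obj D i).left) (b : W ⟶ X j)
        (h : a ≫ (obj D i).hom ≫ f i = b ≫ f j), tr D a b h ≫ κ j = a ≫ κ i := by
  classical
  obtain ⟨F, hF, κ₀, p, hp, hκ, hs⟩ := Presheaf.exists_isSheaf_glue
    (fun i ↦ sectionsPresheaf (obj D i).left) (isSheaf_sectionsPresheaf M)
    (fun i ↦ sectionsMap ((obj D i).hom ≫ f i)) (relatedSetoid D)
    (fun U V g i j x y h ↦ Related.restrict g h)
    (fun U T hT i j x y h ↦ Related.of_locally hT h)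
    (fun U i j x y h ↦ h.mapSection_eq)
  have hF' := (isSheaf_iff_isSheaf_of_type _ _).1 hF
  obtain ⟨κ, κ_eq⟩ : ∃ κ : ∀ (i : ι) {U : C}, (obj D i).left.val.obj (op U) → F.obj (op U),
    ∀ i U, κ i (U := U) = fun x ↦ (κ₀ i).app (op U) x := ⟨_, fun _ _ ↦ rfl⟩
  have κ_map {U V : C} (g : V ⟶ U) (i) (x : (obj D i).left.val.obj (op U)) :
      F.map g.op (κ i x) = κ i (restrict (obj D i).left g x) := by
    rw [κ_eq, κ_eq]
    exact ((κ₀ i).naturality_apply g.op x).symm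
  replace hp {U : C} (i) (x : (obj D i).left.val.obj (op U)) :
      p.app (op U) (κ i x) = mapSection ((obj D i).hom ≫ f i) x := by
    rw [κ_eq]
    exact ConcreteCategory.congr_hom (congr_app (hp i) (op U)) x
  replace hκ {U : C} (i j) (x : (obj D i).left.val.obj (op U))
      (y : (obj D j).left.val.obj (op U)) : κ i x = κ j y ↔ Related D x y := by
    rw [κ_eq, κ_eq]
    exact hκ U i j x y
  replace hs (U : C) (s : F.obj (op U)) : ∃ T ∈ J U, ∀ ⦃V : C⦄ (g : V ⟶ U), T g →
      ∃ i, ∃ x : (obj D i).left.val.obj (op V), κ i x = F.map g.op s := by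
    simp only [κ_eq]
    exact hs U s
  clear κ_eq
  have p_map {U V : C} (g : V ⟶ U) (s : F.obj (op U)) :
      p.app (op V) (F.map g.op s) = restrict M g (p.app (op U) s) :=
    p.naturality_apply g.op s
  have hE {U : C} (i : ι) (δ δ' : (obj D i).left.val.obj (op U)) (h : κ i δ = κ i δ')
      (h' : mapSection (obj D i).hom δ = mapSection (obj D i).hom δ') : δ = δ' :=
    (Related.existsUnique (D := D) δ _ (mapSection_comp _ _ _)).unique ⟨.refl δ, rfl⟩
      ⟨(hκ i i δ δ').1 h, h'.symm⟩
  -- On sections, `D i` is the fibre product of `F` and `X i` over `M`. Locally `s` comes from some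
  -- `D j`; its transport over `y` is a lift to `D i`, unique by `hE`, so the local lifts glue.
  have hP {U : C} (s : F.obj (op U)) (i : ι) (y : (X i).val.obj (op U))
      (h : p.app (op U) s = mapSection (f i) y) :
      ∃! δ, κ i δ = s ∧ mapSection (obj D i).hom δ = y := by
    refine existsUnique_of_exists_of_unique ?_ fun δ δ' h h' ↦
      hE i δ δ' (h.1.trans h'.1.symm) (h.2.trans h'.2.symm)
    obtain ⟨T, hT, H⟩ := hs U s
    have H' ⦃V : C⦄ (g : V ⟶ U) (hg : T g) :
        ∃ δ, κ i δ = F.map g.op s ∧ mapSection (obj D i).hom δ = restrict _ g y := by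
      obtain ⟨j, x, hx⟩ := H g hg
      obtain ⟨δ, ⟨hδ, hδ'⟩, -⟩ := Related.existsUnique (D := D) x (restrict _ g y) (by
        rw [← hp, hx, p_map, h, restrict_mapSection])
      exact ⟨δ, ((hκ _ _ _ _).2 hδ.symm).trans hx, hδ'⟩
    obtain ⟨δ, hδ⟩ := exists_section_of_locally_unique (obj D i).left
      (fun V (g : V ⟶ U) δ ↦ κ i δ = F.map g.op s ∧ mapSection (obj D i).hom δ = restrict _ g y)
      (fun V W h g δ hδ ↦ ⟨by rw [← κ_map, hδ.1, op_comp, Functor.map_comp_apply],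
        by rw [← restrict_mapSection, hδ.2, restrict_comp]⟩)
      (fun V g δ δ' h h' ↦ hE i δ δ' (h.1.trans h'.1.symm) (h.2.trans h'.2.symm)) hT H'
    refine ⟨δ, (hF'.isSeparated T hT).ext fun V g hg ↦ ?_, section_ext _ hT fun V g hg ↦ ?_⟩
    all_goals obtain ⟨δ', h₁, h₂⟩ := H' g hg
    · rw [κ_map, hδ g δ' ⟨h₁, h₂⟩, h₁]
    · rw [restrict_mapSection, hδ g δ' ⟨h₁, h₂⟩, h₂]
  -- The images in `M` lift locally to one `X i`, and `hP` turns these lifts into lifts to `D i`.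
  have hlift (U : C) (Λ : Finset (F.obj (op U))) : ∃ T ∈ J U, ∀ ⦃V : C⦄ (g : V ⟶ U), T g →
      ∃ i, ∀ s ∈ Λ, ∃ x, κ i x = F.map g.op s := by
    obtain ⟨T, hT, H⟩ := hf U (Λ.image (p.app (op U)))
    refine ⟨T, hT, fun V g hg ↦ ?_⟩
    obtain ⟨i, hi⟩ := H g hg
    refine ⟨i, fun s hs ↦ ?_⟩
    obtain ⟨y, hy⟩ := hi _ (Finset.mem_image_of_mem _ hs)
    obtain ⟨δ, ⟨hδ, -⟩, -⟩ := hP (F.map g.op s) i y (by rw [hy, p_map])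
    exact ⟨δ, hδ⟩
  obtain ⟨E, θ, κ', hκ'⟩ := exists_sheafOfModules_glue (fun i ↦ (obj D i).left) hF κ κ_map hlift
    (fun U i j n a x y h ↦ (hκ _ _ _ _).2 (.sum_smul a fun k ↦ (hκ _ _ _ _).1 (h k)))
  have hκ'_inv {U : C} (i : ι) (x : (obj D i).left.val.obj (op U)) (s : E.val.obj (op U)) :
      mapSection (κ' i) x = s ↔ κ i x = θ.inv.app (op U) s := by
    rw [hκ']
    constructor
    · rintro rfl
      exact (θ.hom_inv_id_app_apply (op U) _).symm
    · intro h
      rw [h]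
      exact θ.inv_hom_id_app_apply (op U) s
  have inv_map {U V : C} (g : V ⟶ U) (s : E.val.obj (op U)) :
      θ.inv.app (op V) (restrict E g s) = F.map g.op (θ.inv.app (op U) s) :=
    θ.inv.naturality_apply g.op s
  have hrel {U : C} (i j) (x : (obj D i).left.val.obj (op U))
      (y : (obj D j).left.val.obj (op U)) :
      mapSection (κ' i) x = mapSection (κ' j) y ↔ Related D x y := by
    rw [hκ'_inv, ← (hκ'_inv j y _).1 rfl, hκ]
  have hcov : IsCoveringFamily κ' := fun U Λ ↦ by
    obtain ⟨T, hT, H⟩ := hlift U (Λ.image (θ.inv.app (op U)))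
    refine ⟨T, hT, fun V g hg ↦ ?_⟩
    obtain ⟨i, hi⟩ := H g hg
    refine ⟨i, fun s hs ↦ ?_⟩
    obtain ⟨x, hx⟩ := hi _ (Finset.mem_image_of_mem _ hs)
    exact ⟨x, (hκ'_inv _ _ _).2 (by rw [hx, inv_map])⟩
  -- The map `p` is only one of sheaves of sets. Its linear version is glued from the maps on the
  -- members and then identified with `p` in `hψp`.
  obtain ⟨ψ, hψ, -⟩ := exists_hom_of_isCoveringFamily hcov (fun i ↦ (obj D i).hom ≫ f i)
    (fun Z i j a b h ↦ hom_ext_sections fun U z ↦ by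
      rw [mapSection_comp, mapSection_comp]
      refine Related.mapSection_eq ((hrel _ _ _ _).1 ?_)
      rw [← mapSection_comp, h, mapSection_comp]
      rfl)
  have hψp {U : C} (s : E.val.obj (op U)) :
      mapSection ψ s = p.app (op U) (θ.inv.app (op U) s) := by
    obtain ⟨T, hT, H⟩ := hs U (θ.inv.app (op U) s)
    refine section_ext M hT fun V g hg ↦ ?_
    obtain ⟨i, x, hx⟩ := H g hg
    rw [← inv_map, ← hκ'_inv] at hx
    rw [restrict_mapSection, ← p_map, ← inv_map, ← hx, ← mapSection_comp, hψ,
      ← (hκ'_inv i x _).1 rfl, hp]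
  refine ⟨Over.mk ψ, κ', fun i ↦ isPullback_of_sections (hψ i) fun U x y h ↦ ?_, ?_⟩
  · simp only [hκ'_inv]
    exact hP _ i y ((hψp x).symm.trans h)
  · intro W i j a b h
    refine hom_ext_sections fun U z ↦ ?_
    rw [mapSection_comp, mapSection_comp]
    exact ((hrel _ _ _ _).2 (related_tr a b h z)).symm

end

end ModuleSite

/-- The arrow category of sheaves of `A`-modules on a small site, with the codomain functor
`Arrow.rightFunc`, is a stack over the site `A-mod`. -/
theorem mainTheorem2 {C : Type u} [SmallCategory C] (J : GrothendieckTopology C)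
    (A : Sheaf J RingCat.{u}) :
    IsStackOver (Arrow.rightFunc : Arrow (SheafOfModules.{u} A) ⥤ SheafOfModules.{u} A)
      (modTopology A) := by
  obtain ⟨e, he⟩ := CoGrothendieckOver.exists_equivalence_arrow (SheafOfModules.{u} A)
  exact ⟨inferInstance, overPseudofunctor _, e, he, isStack_overPseudofunctor _
    fun R hR D ↦ ModuleSite.exists_glued_over D hR⟩
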